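/- For $s\in\mathbb C$ write $s=\sigma+it$ with $\sigma,t\in\mathbb R$. Let $$\mathcal R(s)=\int_{0\swarrow1}\frac{x^{-s}e^{\pi i x^2}}{e^{\pi i x}-e^{-\pi i x}}\,dx$$ be Riemann's auxiliary function, where the path of integration is the line through $\tfrac12$ of direction $e^{\pi i/4}$, run through from upper right to lower left, and $x^{-s}$ has its principal value. Let $\chi(s)=2^s\pi^{s-1}\sin(\pi s/2)\,\Gamma(1-s)$ be the factor in the functional equation $\zeta(s)=\chi(s)\zeta(1-s)$, and let $\eta=\eta(s)$ be the square root $\eta=\sqrt{\frac{s-1}{2\pi i}}$ with $-\frac{\pi}{4}<\arg\eta<\frac{3\pi}{4}$ (defined for $s\notin[1,\infty)$); $\eta^{s-1}$ has its principal value. Let $G$ be the set of all $s\in\mathbb C$ with $$\sigma<0,\qquad |s-1|\ge 5408\pi,\qquad t\ge-\tfrac{99}{20}(1-\sigma),\qquad (1-\sigma)^2\ge225\pi t .$$ Then: 1. $G$ is a closed subset of $\mathbb C$. 2. There is a function $U$, holomorphic on a neighbourhood of $G$, such that for every $s\in G$ one has $|U(s)|<0.9$ and $$\mathcal R(s)=-\chi(s)\,\eta^{s-1}e^{-\pi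 i\eta^2}\,\frac{\sqrt2\,e^{3\pi i/8}\sin\pi\eta}{2\cos2\pi\eta}\,\bigl(1+U(s)\bigr).$$ 3. The zeros of $\mathcal R$ in $G$ are exactly the negative even integers $-2,-4,-6,\dots$ that lie in $G$ (the trivial zeros). 4. Every zero of $\mathcal R$ in $G$ is simple. -/

import Mathlib

noncomputable section

namespace RiemannAux

/-- The integrand `x^{-s} e^{π i x²} / (e^{π i x} - e^{-π i x})`, with the principal branch of
`x^{-s}`. -/
def integrand (s x : ℂ) : ℂ :=
  x ^ (-s) * Complex.exp (Real.pi * Complex.I * x ^ 2) /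
    (Complex.exp (Real.pi * Complex.I * x) - Complex.exp (-(Real.pi * Complex.I * x)))

/-- The line through `1/2` of slope `1`, parametrized by arc length from lower left to upper
right. It meets the real axis only at `1/2` and avoids the cut `(-∞, 0]`. -/
def path (u : ℝ) : ℂ :=
  1 / 2 + u * Complex.exp (Real.pi * Complex.I / 4)

/-- Riemann's auxiliary function
`R(s) = ∫_{0 ↙ 1} x^{-s} e^{π i x²} / (e^{π i x} - e^{-π i x}) dx`.
The line of integration is run through from upper right to lower left, against the orientation
of `path`, hence the minus sign. -/
def R (s : ℂ) : ℂ :=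
  -∫ u : ℝ, integrand s (path u) * Complex.exp (Real.pi * Complex.I / 4)

/-- The factor of the functional equation `ζ(s) = χ(s) ζ(1 - s)`,
`χ(s) = 2^s π^{s-1} sin(π s / 2) Γ(1 - s)`. -/
def chi (s : ℂ) : ℂ :=
  2 ^ s * (Real.pi : ℂ) ^ (s - 1) * Complex.sin (Real.pi * s / 2) * Complex.Gamma (1 - s)

/-- The square root `η` of `(s - 1) / (2 π i)` with `-π/4 < arg η < 3π/4`, for `s` off the ray
`[1, ∞)`; see `eta_sq` and `arg_eta`. -/
def eta (s : ℂ) : ℂ :=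
  Complex.exp (Real.pi * Complex.I / 4) * ((1 - s) / (2 * Real.pi)) ^ (1 / 2 : ℂ)

theorem eta_sq (s : ℂ) : eta s ^ 2 = (s - 1) / (2 * Real.pi * Complex.I) := by
  have h1 : Complex.exp (Real.pi * Complex.I / 4) ^ 2 = Complex.I := by
    have h : ((2 : ℕ) : ℂ) * (Real.pi * Complex.I / 4) = Real.pi / 2 * Complex.I := by
      push_cast
      ring
    rw [← Complex.exp_nat_mul, h, Complex.exp_pi_div_two_mul_I]
  have h2 : (((1 - s) / (2 * Real.pi)) ^ (1 / 2 : ℂ)) ^ 2 = (1 - s) / (2 * Real.pi) := by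
    rw [← Complex.cpow_nat_mul]
    norm_num
  have hpi : (Real.pi : ℂ) ≠ 0 := by exact_mod_cast Real.pi_ne_zero
  rw [eta, mul_pow, h1, h2]
  field_simp
  rw [Complex.I_sq]
  ring

theorem arg_eta (s : ℂ) (hs : 1 - s ∈ Complex.slitPlane) :
    -(Real.pi / 4) < (eta s).arg ∧ (eta s).arg < 3 * Real.pi / 4 := by
  have hpi := Real.pi_pos
  have hz : (1 - s) / (2 * Real.pi) ∈ Complex.slitPlane := by
    have h : (1 - s) / (2 * Real.pi) = (((2 * Real.pi)⁻¹ : ℝ) : ℂ) * (1 - s) := by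
      push_cast
      rw [div_eq_inv_mul]
    rw [h, Complex.mem_slitPlane_iff_arg, Complex.arg_real_mul _ (by positivity)]
    rw [Complex.mem_slitPlane_iff_arg] at hs
    refine ⟨hs.1, mul_ne_zero ?_ hs.2⟩
    exact_mod_cast (by positivity : (2 * Real.pi)⁻¹ ≠ 0)
  set z := (1 - s) / (2 * Real.pi) with hzdef
  rw [Complex.mem_slitPlane_iff_arg] at hz
  have h1 : -Real.pi < z.arg := Complex.neg_pi_lt_arg z
  have h2 : z.arg < Real.pi := lt_of_le_of_ne (Complex.arg_le_pi z) hz.1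
  have key : (eta s).arg = Real.pi / 4 + z.arg / 2 := by
    have e : eta s = Complex.exp (Real.pi * Complex.I / 4 + Complex.log z * (1 / 2)) := by
      rw [Complex.exp_add, eta, ← hzdef, Complex.cpow_def_of_ne_zero hz.2]
    have him : (Real.pi * Complex.I / 4 + Complex.log z * (1 / 2)).im
        = Real.pi / 4 + z.arg / 2 := by
      have : (Real.pi * Complex.I / 4 + Complex.log z * (1 / 2))
          = ((1 / 2 : ℝ) : ℂ) * Complex.log z + ((Real.pi / 4 : ℝ) : ℂ) * Complex.I := by
        push_cast
        ring
      rw [this, Complex.add_im, Complex.im_ofReal_mul,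
        Complex.log_im, Complex.im_ofReal_mul, Complex.I_im]
      ring
    rw [e, Complex.arg_exp, him, toIocMod_eq_self]
    constructor <;> linarith
  rw [key]
  constructor <;> linarith

/-- The set `G`: `σ < 0`, `|s - 1| ≥ 5408 π`, `t ≥ -(99/20)(1 - σ)` and `(1 - σ)² ≥ 225 π t`,
where `s = σ + i t`. -/
def G : Set ℂ :=
  {s | s.re < 0 ∧ 5408 * Real.pi ≤ ‖s - 1‖ ∧ -(99 / 20) * (1 - s.re) ≤ s.im ∧
    225 * Real.pi * s.im ≤ (1 - s.re) ^ 2}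

/-- The main term
`-χ(s) η^{s-1} e^{-π i η²} · √2 e^{3 π i / 8} sin(π η) / (2 cos(2 π η))`. -/
def mainTerm (s : ℂ) : ℂ :=
  -chi s * eta s ^ (s - 1) * Complex.exp (-(Real.pi * Complex.I * eta s ^ 2)) *
    ((Real.sqrt 2 : ℂ) * Complex.exp (3 * Real.pi * Complex.I / 8) *
        Complex.sin (Real.pi * eta s) /
      (2 * Complex.cos (2 * Real.pi * eta s)))

end RiemannAux

end

open Complex MeasureTheory Filter Set Topology

namespace RiemannAux

/-! For σ < -1 the factor `x ^ (-s)` kills the pole of the integrand at 0, so the line of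
integration may be moved to pass through the origin. It then consists of two opposite rays, and on
each of them the integral is an elementary multiple of one Mellin transform M(1-s), that of
`rayKernel`. The two multiples combine into a sine (`R_eq_mellin`): R(s) = e^{πi/4} e^{πis/4}
sin(πs/2) M(1-s). All claims about zeros follow once M(1-s) ≠ 0 on G. This nonvanishing is part of
the asymptotic formula, since |U| < 0.9 forces 1 + U ≠ 0.

To estimate M(l) with l = 1-s, expand 1/sin in a geometric series with frequencies κ = K e^{-πi/4},
K = k + 1/2. Writing the Gaussian as its own Fourier transform turns each term into a common
constant times ∫ w^{-l} e^{πw² - 2πκw} along a vertical line (`integral_cpow_mul_gaussian`,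
`mellin_rayKernel_eq`). The line is free in the right half-plane, so each term gets one suited to
its saddle point. With l = 2πp² and p = η e^{-πi/4}:

The term k = 0 is taken on the line through p, the saddle for κ = 0. The quadratic approximation of
the exponent gives e^{πi/8}/√2 times the size of the integrand there, and Re p ≥ 36 bounds the cubic
remainder by 0.4 (`vertInt_main`).

The terms k ≥ 1 are taken on the lines through their own saddles. The integral is at most twice the
integrand at the saddle (`norm_vertInt_le`), whose decay in K comes from differentiating the
critical value with respect to K (`hasDerivAt_phase_saddle`, `norm_exp_phase_saddle_le`). Together
these terms contribute at most 0.04.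

Finally sin(πη)/(2cos(2πη)) equals (i/2)e^{πiη} up to a factor that is close to 1 because Im η ≥ 5,
so the first term is essentially the stated main term (`mainFactor_eq`, `ratio_bound`). In terms of
η, the inequalities defining G give precisely the size and angle bounds used above (`eta_bounds`).
-/

/-! ### Cauchy's theorem in a strip and the direction e^{πi/4}. -/

/-- Cauchy's theorem for a horizontal strip: the integrals along the two boundary lines agree if
the function decays like `exp (-u ^ 2)`. -/
theorem integral_strip_eq {g : ℂ → ℂ} {a b : ℝ} (hab : a ≤ b)
    (hc : ContinuousOn g {z | a ≤ z.im ∧ z.im ≤ b})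
    (hd : DifferentiableOn ℂ g {z | a < z.im ∧ z.im < b}) {C : ℝ}
    (hC : ∀ u y : ℝ, 1 ≤ |u| → a ≤ y → y ≤ b → ‖g (u + y * I)‖ ≤ C * Real.exp (-u ^ 2)) :
    Integrable (fun u : ℝ => g (u + a * I)) ∧ Integrable (fun u : ℝ => g (u + b * I)) ∧
      ∫ u : ℝ, g (u + a * I) = ∫ u : ℝ, g (u + b * I) := by
  have hint : ∀ y, a ≤ y → y ≤ b → Integrable (fun u : ℝ => g (u + y * I)) := by
    intro y h1 h2
    have hcont : Continuous (fun u : ℝ => g (u + y * I)) := by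
      refine hc.comp_continuous (by fun_prop) ?_
      intro u
      simpa using ⟨h1, h2⟩
    have hO : ∀ l : Filter ℝ, (∀ᶠ u in l, 1 ≤ |u|) →
        (fun u : ℝ => g (u + y * I)) =O[l] fun u : ℝ => Real.exp (-1 * u ^ 2) := by
      intro l hl
      refine Asymptotics.IsBigO.of_bound C ?_
      filter_upwards [hl] with u hu
      rw [Real.norm_of_nonneg (Real.exp_pos _).le]
      simpa using hC u y hu h1 h2
    have hG := integrable_exp_neg_mul_sq (b := 1) one_pos
    refine hcont.locallyIntegrable.integrable_of_isBigO_atBot_atTop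
      (hO _ ?_) (hG.integrableAtFilter _) (hO _ ?_) (hG.integrableAtFilter _)
    · filter_upwards [eventually_le_atBot (-1 : ℝ)] with u hu
      rw [le_abs]; right; linarith
    · filter_upwards [eventually_ge_atTop (1 : ℝ)] with u hu
      rw [le_abs]; left; linarith
  have ha := hint a le_rfl hab
  have hb := hint b hab le_rfl
  refine ⟨ha, hb, ?_⟩
  have t1 := (intervalIntegral_tendsto_integral ha tendsto_neg_atTop_atBot tendsto_id).sub
    (intervalIntegral_tendsto_integral hb tendsto_neg_atTop_atBot tendsto_id)
  rw [← sub_eq_zero]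
  refine tendsto_nhds_unique t1 ?_
  rw [tendsto_zero_iff_norm_tendsto_zero]
  have hlim : Tendsto (fun T : ℝ => 2 * (C * Real.exp (-T ^ 2) * |b - a|)) atTop (𝓝 0) := by
    have h0 : Tendsto (fun T : ℝ => Real.exp (-T ^ 2)) atTop (𝓝 0) :=
      Real.tendsto_exp_atBot.comp
        (tendsto_neg_atTop_atBot.comp (tendsto_pow_atTop two_ne_zero))
    simpa using ((h0.const_mul C).mul_const |b - a|).const_mul 2
  refine squeeze_zero' (Eventually.of_forall fun _ => norm_nonneg _) ?_ hlim
  filter_upwards [eventually_ge_atTop (1 : ℝ)] with T hT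
  have hrect := Complex.integral_boundary_rect_eq_zero_of_continuousOn_of_differentiableOn g
    (⟨-T, a⟩ : ℂ) (⟨T, b⟩ : ℂ) (hc.mono ?_) (hd.mono ?_)
  · have hside : ∀ u : ℝ, |u| = T →
        ‖∫ y : ℝ in a..b, g (u + y * I)‖ ≤ C * Real.exp (-T ^ 2) * |b - a| := by
      intro u hu
      refine intervalIntegral.norm_integral_le_of_norm_le_const ?_
      intro y hy
      rw [uIoc_of_le hab] at hy
      have := hC u y (by rw [hu]; exact hT) hy.1.le hy.2
      rwa [← sq_abs u, hu] at this
    have s1 := hside T (abs_of_nonneg (by linarith))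
    have s2 := hside (-T) (by rw [abs_neg]; exact abs_of_nonneg (by linarith))
    simp only [smul_eq_mul] at hrect
    have e : (∫ x : ℝ in -T..T, g (x + a * I)) - (∫ x : ℝ in -T..T, g (x + b * I)) =
        I * (∫ y : ℝ in a..b, g ((-T : ℝ) + y * I)) - I * ∫ y : ℝ in a..b, g (T + y * I) := by
      linear_combination hrect
    simp only [id]
    rw [e]
    refine (norm_sub_le _ _).trans ?_
    rw [norm_mul, norm_mul, norm_I, one_mul, one_mul]
    linarith
  · rintro z ⟨_, hz⟩
    simp only [mem_preimage, uIcc_of_le hab] at hz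
    exact hz
  · rintro z ⟨_, hz⟩
    simp only [mem_preimage, min_eq_left hab, max_eq_right hab] at hz
    exact hz

/-- The unit vector `e^{π i / 4}`. -/
noncomputable def diag : ℂ := exp (Real.pi * I / 4)

theorem diag_eq : diag = (Real.sqrt 2 / 2 : ℝ) + (Real.sqrt 2 / 2 : ℝ) * I := by
  have : (Real.pi * I / 4 : ℂ) = (Real.pi / 4 : ℝ) * I := by push_cast; ring
  rw [diag, this, exp_mul_I, ← ofReal_cos, ← ofReal_sin, Real.cos_pi_div_four,
    Real.sin_pi_div_four]

theorem diag_re : diag.re = Real.sqrt 2 / 2 := by rw [diag_eq]; simp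

theorem diag_im : diag.im = Real.sqrt 2 / 2 := by rw [diag_eq]; simp

theorem diag_sq : diag ^ 2 = I := by
  have h : ((2 : ℕ) : ℂ) * (Real.pi * I / 4) = Real.pi / 2 * I := by push_cast; ring
  rw [diag, ← Complex.exp_nat_mul, h, Complex.exp_pi_div_two_mul_I]

theorem diag_ne_zero : diag ≠ 0 := exp_ne_zero _

theorem norm_diag : ‖diag‖ = 1 := by
  have : (Real.pi * I / 4 : ℂ) = (Real.pi / 4 : ℝ) * I := by push_cast; ring
  rw [diag, this, norm_exp_ofReal_mul_I]

/-! ### Moving the line of integration to the origin. -/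

theorem exp_sub_exp_eq_sin (x : ℂ) :
    exp (Real.pi * I * x) - exp (-(Real.pi * I * x)) = 2 * I * sin (Real.pi * x) := by
  rw [Complex.sin]
  have e1 : Real.pi * I * x = Real.pi * x * I := by ring
  have e2 : -(Real.pi * I * x) = -(Real.pi * x) * I := by ring
  rw [e2, e1]
  linear_combination (exp (Real.pi * x * I) - exp (-(Real.pi * x) * I)) * I_sq

theorem integrand_eq (s x : ℂ) :
    integrand s x = x ^ (-s) * exp (Real.pi * I * x ^ 2) / (2 * I * sin (Real.pi * x)) := by
  rw [integrand, exp_sub_exp_eq_sin]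

theorem abs_sinh_im_le_norm_sin (z : ℂ) : |Real.sinh z.im| ≤ ‖sin z‖ := by
  have h1 := abs_norm_sub_norm_le (exp (-z * I)) (exp (z * I))
  rw [norm_exp, norm_exp] at h1
  simp only [mul_re, neg_re, neg_im, I_re, I_im, mul_zero, mul_one, zero_sub, neg_neg] at h1
  rw [Complex.sin, norm_div, norm_mul, norm_I, mul_one, Real.sinh_eq, abs_div]
  simp only [Complex.norm_ofNat, Nat.abs_ofNat]
  gcongr

theorem norm_cpow_le_mul_exp (x w : ℂ) :
    ‖x ^ w‖ ≤ ‖x‖ ^ w.re * Real.exp (Real.pi * |w.im|) := by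
  refine (norm_cpow_le x w).trans ?_
  rw [div_eq_mul_inv, ← Real.exp_neg]
  gcongr
  calc -(x.arg * w.im) ≤ |x.arg * w.im| := neg_le_abs _
    _ = |x.arg| * |w.im| := abs_mul _ _
    _ ≤ Real.pi * |w.im| := by gcongr; exact abs_arg_le_pi x

theorem diag_mul_re (u y : ℝ) : (diag * (u + y * I)).re = Real.sqrt 2 / 2 * (u - y) := by
  simp [diag_re, diag_im]; ring

theorem diag_mul_im (u y : ℝ) : (diag * (u + y * I)).im = Real.sqrt 2 / 2 * (u + y) := by
  simp [diag_re, diag_im]; ring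

theorem sqrt_two_mul_self_complex : ((Real.sqrt 2 : ℝ) : ℂ) * (Real.sqrt 2 : ℝ) = 2 := by
  rw [← ofReal_mul, Real.mul_self_sqrt (by norm_num)]; norm_num

theorem path_eq (u : ℝ) :
    path u = diag * (((u + Real.sqrt 2 / 4 : ℝ) : ℂ) + ((-(Real.sqrt 2 / 4) : ℝ) : ℂ) * I) := by
  have h : path u = 1 / 2 + u * diag := rfl
  rw [h, diag_eq]
  push_cast
  linear_combination (-1 / 4 : ℂ) * sqrt_two_mul_self_complex
    + (Real.sqrt 2 : ℂ) * Real.sqrt 2 / 8 * I_sq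

/-- The rotated strip lies between the parallel lines through 0 and 1/2, so apart from 0 it meets
the real axis only inside (0, 1), away from both the cut and the integers. -/
theorem diag_mul_mem_of_strip {z : ℂ} (h1 : -(Real.sqrt 2 / 4) ≤ z.im) (h2 : z.im ≤ 0)
    (hz : z ≠ 0) : diag * z ∈ slitPlane ∧ sin (Real.pi * (diag * z)) ≠ 0 := by
  have hs : 0 < Real.sqrt 2 := by positivity
  have hs2 : Real.sqrt 2 * Real.sqrt 2 = 2 := Real.mul_self_sqrt (by norm_num)
  have hre : (diag * z).re = Real.sqrt 2 / 2 * (z.re - z.im) := by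
    rw [← diag_mul_re, re_add_im]
  have him : (diag * z).im = Real.sqrt 2 / 2 * (z.re + z.im) := by
    rw [← diag_mul_im, re_add_im]
  have hpos : (diag * z).im = 0 → 0 < (diag * z).re ∧ (diag * z).re < 1 := by
    intro h
    rw [him] at h
    have h3 : z.re = -z.im := by
      rcases mul_eq_zero.1 h with h | h
      · linarith
      · linarith
    have h4 : z.im ≠ 0 := by
      intro h5
      exact hz (Complex.ext (by simp [h3, h5]) (by simp [h5]))
    have h5 : z.im < 0 := lt_of_le_of_ne h2 h4
    rw [hre, h3]
    constructor
    · have : 0 < -z.im - z.im := by linarith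
      positivity
    · nlinarith
  constructor
  · rw [mem_slitPlane_iff]
    by_cases h : (diag * z).im = 0
    · exact Or.inl (hpos h).1
    · exact Or.inr h
  · intro h
    rw [sin_eq_zero_iff] at h
    obtain ⟨k, hk⟩ := h
    have hpi : (Real.pi : ℂ) ≠ 0 := by exact_mod_cast Real.pi_ne_zero
    have hk' : diag * z = k := by
      apply mul_left_cancel₀ hpi
      rw [hk]; ring
    have h0 := hpos (by rw [hk']; simp)
    rw [hk'] at h0
    simp only [intCast_re] at h0
    have a1 : (0 : ℤ) < k := by exact_mod_cast h0.1
    have a2 : k < (1 : ℤ) := by exact_mod_cast h0.2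
    omega

theorem differentiableAt_integrand {s x : ℂ} (hx : x ∈ slitPlane)
    (hsin : sin (Real.pi * x) ≠ 0) : DifferentiableAt ℂ (integrand s) x := by
  have e : integrand s = fun x => x ^ (-s) * exp (Real.pi * I * x ^ 2) /
      (2 * I * sin (Real.pi * x)) := funext fun x => integrand_eq s x
  rw [e]
  refine DifferentiableAt.div (DifferentiableAt.mul ?_ (by fun_prop)) (by fun_prop) ?_
  · exact (hasStrictDerivAt_cpow_const hx).hasDerivAt.differentiableAt
  · simpa [I_ne_zero] using hsin

/-- Near 0 the integrand is x^{-s-1} times the bounded factor x/sin(πx), and x^{-s-1} tends to 0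
exactly because σ < -1. -/
theorem continuousAt_integrand_zero {s : ℂ} (hs : s.re < -1) : ContinuousAt (integrand s) 0 := by
  have hs0 : s ≠ 0 := by rintro rfl; norm_num at hs
  -- The denominator vanishes at 0, so this is the default value of division by zero; it agrees with
  -- the limit.
  have h0 : integrand s 0 = 0 := by simp [integrand]
  rw [continuousAt_iff_punctured_nhds, h0]
  have hd : HasDerivAt (fun x : ℂ => sin (Real.pi * x)) Real.pi 0 := by
    have := ((hasDerivAt_id (0 : ℂ)).const_mul (Real.pi : ℂ)).csin
    simpa using this
  have hslope := hd.tendsto_slope_zero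
  have hpow : Tendsto (fun x : ℂ => x ^ (-s - 1)) (𝓝[≠] 0) (𝓝 0) := by
    have h1 : Tendsto (fun x : ℂ => ‖x‖ ^ (-s - 1).re * Real.exp (Real.pi * |(-s - 1).im|))
        (𝓝[≠] 0) (𝓝 0) := by
      have : 0 < (-s - 1).re := by simp; linarith
      have hc : Continuous fun x : ℂ => ‖x‖ ^ (-s - 1).re * Real.exp (Real.pi * |(-s - 1).im|) :=
        (continuous_norm.rpow_const fun _ => Or.inr this.le).mul continuous_const
      have := hc.tendsto 0
      rw [norm_zero, Real.zero_rpow (by simp; linarith), zero_mul] at this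
      exact this.mono_left nhdsWithin_le_nhds
    exact squeeze_zero_norm (fun x => norm_cpow_le_mul_exp x _) h1
  have hexp : Tendsto (fun x : ℂ => exp (Real.pi * I * x ^ 2)) (𝓝[≠] 0) (𝓝 1) := by
    have hc : Continuous fun x : ℂ => exp (Real.pi * I * x ^ 2) := by fun_prop
    have := hc.tendsto 0
    simp only [ne_eq, OfNat.ofNat_ne_zero, not_false_eq_true, zero_pow, mul_zero, exp_zero] at this
    exact this.mono_left nhdsWithin_le_nhds
  have hpi : (Real.pi : ℂ) ≠ 0 := by exact_mod_cast Real.pi_ne_zero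
  have hall := (hpow.mul hexp).div (hslope.const_mul (2 * I))
    (mul_ne_zero (by simp [I_ne_zero]) hpi)
  rw [zero_mul, zero_div] at hall
  refine hall.congr' ?_
  filter_upwards [self_mem_nhdsWithin] with x hx
  have hx' : x ≠ 0 := hx
  have hcp : x ^ (-s) = x ^ (-s - 1) * x := by
    rw [cpow_sub _ _ hx', cpow_one, div_mul_cancel₀ _ hx']
  simp only [Pi.div_apply, zero_add, mul_zero, sin_zero, sub_zero, smul_eq_mul]
  rw [integrand_eq, hcp]
  field_simp

theorem norm_integrand_strip_le {s : ℂ} (hs : s.re < -1) : ∃ C : ℝ, ∀ u y : ℝ, 1 ≤ |u| →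
    -(Real.sqrt 2 / 4) ≤ y → y ≤ 0 →
      ‖integrand s (diag * (u + y * I))‖ ≤ C * Real.exp (-u ^ 2) := by
  obtain ⟨N, hN⟩ := exists_nat_ge (-s.re)
  -- The power is absorbed by r^N ≤ N! e^r with r = |u| + 1, and the Gaussian gives e^{-3u² + 1}
  -- since π > 3. The 7 leaves ample room for |u| + 2 - 3u² ≤ 7 - u².
  refine ⟨N.factorial * Real.exp 7 * Real.exp (Real.pi * |(-s).im|), ?_⟩
  intro u y hu h1 h2
  have hs2 : Real.sqrt 2 * Real.sqrt 2 = 2 := Real.mul_self_sqrt (by norm_num)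
  have hs1 : 1.4 ≤ Real.sqrt 2 := Real.le_sqrt_of_sq_le (by norm_num)
  have hs3 : Real.sqrt 2 ≤ 1.5 := by rw [Real.sqrt_le_left] <;> norm_num
  have hpi := Real.pi_gt_three
  have hpi4 := Real.pi_le_four
  have hy : |y| ≤ 3 / 8 := by rw [abs_le]; constructor <;> linarith
  have hden : 1 ≤ ‖2 * I * sin (Real.pi * (diag * (u + y * I)))‖ := by
    have h := abs_sinh_im_le_norm_sin (Real.pi * (diag * (u + y * I)))
    rw [im_ofReal_mul, Real.abs_sinh] at h
    have : 1 ≤ |Real.pi * (diag * (u + y * I)).im| := by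
      rw [diag_mul_im, abs_mul, abs_mul, abs_of_pos Real.pi_pos, abs_of_pos (by positivity)]
      have : 5 / 8 ≤ |u + y| := by
        have := abs_sub_abs_le_abs_sub u (-y)
        rw [abs_neg, sub_neg_eq_add] at this
        linarith
      nlinarith [mul_le_mul hs1 this (by norm_num) (by positivity)]
    have h3 := Real.self_le_sinh_iff.2 (abs_nonneg (Real.pi * (diag * (u + y * I)).im))
    rw [norm_mul, norm_mul, norm_I, Complex.norm_ofNat]
    linarith
  have hx : ‖diag * (u + y * I)‖ ≤ |u| + 1 := by
    rw [norm_mul, norm_diag, one_mul]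
    refine (norm_add_le _ _).trans ?_
    rw [norm_mul, norm_I, mul_one, norm_real, norm_real, Real.norm_eq_abs, Real.norm_eq_abs]
    linarith
  have hexp : ‖exp (Real.pi * I * (diag * (u + y * I)) ^ 2)‖ ≤ Real.exp (-(3 * u ^ 2) + 1) := by
    rw [mul_pow, diag_sq, norm_exp]
    have e : (Real.pi * I * (I * (u + y * I) ^ 2) : ℂ) =
        ((-(Real.pi * (u ^ 2 - y ^ 2)) : ℝ) : ℂ) + ((-(2 * Real.pi * u * y) : ℝ) : ℂ) * I := by
      push_cast
      linear_combination (Real.pi * (u + y * I) ^ 2 - Real.pi * y ^ 2 : ℂ) * I_sq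
    rw [e, add_re, ofReal_re, re_ofReal_mul, I_re, mul_zero, add_zero, Real.exp_le_exp]
    have : y ^ 2 ≤ 9 / 64 := by rw [← sq_abs]; nlinarith [abs_nonneg y]
    nlinarith [sq_nonneg u, sq_nonneg y]
  have hpow : ‖(diag * (u + y * I)) ^ (-s)‖ ≤
      N.factorial * Real.exp (|u| + 1) * Real.exp (Real.pi * |(-s).im|) := by
    refine (norm_cpow_le_mul_exp _ _).trans ?_
    gcongr
    calc ‖diag * (u + y * I)‖ ^ (-s).re ≤ (|u| + 1) ^ (-s).re := by
          gcongr; simp; linarith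
      _ ≤ (|u| + 1) ^ (N : ℝ) := by
          gcongr
          · linarith
          · simpa using hN
      _ = (|u| + 1) ^ N := Real.rpow_natCast _ _
      _ ≤ _ := by
          have := Real.pow_div_factorial_le_exp (|u| + 1) (by positivity) N
          rwa [div_le_iff₀ (by positivity), mul_comm] at this
  rw [integrand_eq, norm_div]
  calc _ ≤ ‖(diag * (u + y * I)) ^ (-s) * exp (Real.pi * I * (diag * (u + y * I)) ^ 2)‖ :=
        div_le_self (norm_nonneg _) hden
    _ ≤ N.factorial * Real.exp (|u| + 1) * Real.exp (Real.pi * |(-s).im|) *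
        Real.exp (-(3 * u ^ 2) + 1) := by
        rw [norm_mul]; gcongr
    _ = N.factorial * Real.exp (Real.pi * |(-s).im|) * Real.exp (|u| + 1 + (-(3 * u ^ 2) + 1)) := by
        rw [Real.exp_add (|u| + 1)]; ring
    _ ≤ N.factorial * Real.exp (Real.pi * |(-s).im|) * Real.exp (7 + -u ^ 2) := by
        refine mul_le_mul_of_nonneg_left (Real.exp_le_exp.2 ?_) (by positivity)
        nlinarith [sq_abs u, sq_nonneg (|u| - 1)]
    _ = _ := by rw [Real.exp_add 7]; ring

theorem R_eq_integral_diag {s : ℂ} (hs : s.re < -1) :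
    Integrable (fun u : ℝ => integrand s (diag * u)) ∧
      R s = -(diag * ∫ u : ℝ, integrand s (diag * u)) := by
  obtain ⟨C, hC⟩ := norm_integrand_strip_le hs
  have hab : -(Real.sqrt 2 / 4) ≤ (0 : ℝ) := by
    have := Real.sqrt_nonneg 2
    linarith
  have key := integral_strip_eq (g := fun z => integrand s (diag * z)) hab ?_ ?_ hC
  · obtain ⟨-, h2, h3⟩ := key
    simp only [ofReal_zero, zero_mul, add_zero] at h2 h3
    refine ⟨h2, ?_⟩
    rw [← h3, R]
    rw [integral_mul_const, mul_comm diag]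
    have : ∀ u : ℝ, integrand s (path u) = (fun v : ℝ => integrand s
        (diag * ((v : ℂ) + ((-(Real.sqrt 2 / 4) : ℝ) : ℂ) * I))) (u + Real.sqrt 2 / 4) := by
      intro u
      rw [path_eq]
    simp_rw [this]
    rw [integral_add_right_eq_self (μ := volume) (fun v : ℝ => integrand s
        (diag * ((v : ℂ) + ((-(Real.sqrt 2 / 4) : ℝ) : ℂ) * I)))]
    rfl
  · rintro z ⟨h1, h2⟩
    by_cases hz : z = 0
    · have h : ContinuousAt (integrand s) (diag * z) := by
        rw [hz, mul_zero]; exact continuousAt_integrand_zero hs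
      exact (ContinuousAt.comp (f := fun z => diag * z) h (by fun_prop)).continuousWithinAt
    · obtain ⟨m1, m2⟩ := diag_mul_mem_of_strip h1 h2 hz
      exact (ContinuousAt.comp (f := fun z => diag * z)
        (differentiableAt_integrand m1 m2).continuousAt (by fun_prop)).continuousWithinAt
  · rintro z ⟨h1, h2⟩
    have hz : z ≠ 0 := by rintro rfl; simp at h2
    obtain ⟨m1, m2⟩ := diag_mul_mem_of_strip h1.le h2.le hz
    exact (DifferentiableAt.comp (f := fun z => diag * z) z
        (differentiableAt_integrand m1 m2) (by fun_prop)).differentiableWithinAt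

/-! ### Reduction to a Mellin transform. -/

theorem ofReal_mul_exp_cpow {r θ : ℝ} (hr : 0 < r) (h1 : -Real.pi < θ) (h2 : θ ≤ Real.pi)
    (w : ℂ) : ((r : ℂ) * exp (θ * I)) ^ w = (r : ℂ) ^ w * exp (θ * I * w) := by
  have hr' : (r : ℂ) ≠ 0 := ofReal_ne_zero.2 hr.ne'
  rw [cpow_def_of_ne_zero (mul_ne_zero hr' (exp_ne_zero _)), log_ofReal_mul hr (exp_ne_zero _),
    log_exp (by simpa using h1) (by simpa using h2), cpow_def_of_ne_zero hr', ← exp_add,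
    ofReal_log hr.le]
  ring_nf

/-- The restriction of `e^{π i x²} / sin (π x)` to the ray `x = e^{π i / 4} v`. -/
noncomputable def rayKernel (v : ℝ) : ℂ := exp (-(Real.pi * v ^ 2)) / sin (Real.pi * (diag * v))

theorem exp_diag_mul_sq (v : ℝ) :
    exp (Real.pi * I * (diag * v) ^ 2) = exp (-(Real.pi * v ^ 2)) := by
  rw [mul_pow, diag_sq]
  congr 1
  linear_combination (Real.pi * v ^ 2 : ℂ) * I_sq

theorem integrand_diag_mul_pos (s : ℂ) {v : ℝ} (hv : 0 < v) :
    integrand s (diag * v) =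
      exp (-(Real.pi * I * s / 4)) / (2 * I) * ((v : ℂ) ^ (-s) * rayKernel v) := by
  have h : diag * v = (v : ℂ) * exp ((Real.pi / 4 : ℝ) * I) := by
    rw [mul_comm, diag]; congr 2; push_cast; ring
  have hp : (diag * v) ^ (-s) = (v : ℂ) ^ (-s) * exp (-(Real.pi * I * s / 4)) := by
    rw [h, ofReal_mul_exp_cpow hv (by linarith [Real.pi_pos]) (by linarith [Real.pi_pos])]
    congr 2
    push_cast
    ring
  rw [integrand_eq, exp_diag_mul_sq, hp, rayKernel, mul_comm (2 * I), ← div_div]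
  ring

theorem integrand_diag_mul_neg (s : ℂ) {v : ℝ} (hv : 0 < v) :
    integrand s (diag * ((-v : ℝ) : ℂ)) =
      -exp (3 * Real.pi * I * s / 4) / (2 * I) * ((v : ℂ) ^ (-s) * rayKernel v) := by
  -- The principal argument on the lower-left ray is -3π/4, not 5π/4.
  have h : diag * ((-v : ℝ) : ℂ) = (v : ℂ) * exp ((-(3 * Real.pi / 4) : ℝ) * I) := by
    have e : ((-(3 * Real.pi / 4) : ℝ) : ℂ) * I = Real.pi * I / 4 - Real.pi * I := by
      push_cast; ring
    rw [e, exp_sub, exp_pi_mul_I, diag]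
    push_cast
    ring
  have hp : (diag * ((-v : ℝ) : ℂ)) ^ (-s) =
      (v : ℂ) ^ (-s) * exp (3 * Real.pi * I * s / 4) := by
    rw [h, ofReal_mul_exp_cpow hv (by linarith [Real.pi_pos]) (by linarith [Real.pi_pos])]
    congr 2
    push_cast
    ring
  rw [integrand_eq, exp_diag_mul_sq, hp, rayKernel]
  have e2 : (Real.pi * (diag * ((-v : ℝ) : ℂ)) : ℂ) = -(Real.pi * (diag * v)) := by
    push_cast; ring
  rw [e2, sin_neg, ofReal_neg, neg_sq, mul_neg, div_neg, mul_comm (2 * I), ← div_div]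
  ring

/-- The two rays carry the phases e^{-πis/4} and -e^{3πis/4}, the minus sign coming from the oddness
of the sine. Taking out e^{πis/4} leaves e^{∓πis/2}, whose difference is the factor sin(πs/2) that
produces the trivial zeros. -/
theorem R_eq_mellin {s : ℂ} (hs : s.re < -1) :
    R s = diag * exp (Real.pi * I * s / 4) * sin (Real.pi * s / 2) * mellin rayKernel (1 - s) := by
  obtain ⟨hint, hR⟩ := R_eq_integral_diag hs
  rw [hR, ← intervalIntegral.integral_Iic_add_Ioi (b := 0) hint.integrableOn hint.integrableOn]
  have h0 := integral_comp_neg_Ioi 0 (fun u : ℝ => integrand s (diag * u))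
  rw [neg_zero] at h0
  rw [← h0]
  have e1 : ∫ v in Ioi (0 : ℝ), integrand s (diag * ((-v : ℝ) : ℂ)) =
      -exp (3 * Real.pi * I * s / 4) / (2 * I) * mellin rayKernel (1 - s) := by
    rw [mellin, ← integral_const_mul]
    refine setIntegral_congr_fun measurableSet_Ioi fun v hv => ?_
    simp only [smul_eq_mul]
    rw [integrand_diag_mul_neg s hv, show 1 - s - 1 = -s by ring]
  have e2 : ∫ v in Ioi (0 : ℝ), integrand s (diag * v) =
      exp (-(Real.pi * I * s / 4)) / (2 * I) * mellin rayKernel (1 - s) := by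
    rw [mellin, ← integral_const_mul]
    refine setIntegral_congr_fun measurableSet_Ioi fun v hv => ?_
    simp only [smul_eq_mul]
    rw [integrand_diag_mul_pos s hv, show 1 - s - 1 = -s by ring]
  rw [e1, e2, Complex.sin]
  have x1 : exp (3 * Real.pi * I * s / 4) =
      exp (Real.pi * I * s / 4) * exp (Real.pi * s / 2 * I) := by
    rw [← exp_add]; ring_nf
  have x2 : exp (-(Real.pi * I * s / 4)) =
      exp (Real.pi * I * s / 4) * exp (-(Real.pi * s / 2) * I) := by
    rw [← exp_add]; ring_nf
  rw [x1, x2]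
  have hI : (1 : ℂ) / (2 * I) = -I / 2 := by
    field_simp
    linear_combination I_sq
  rw [div_eq_mul_one_div, div_eq_mul_one_div (exp _ * _), hI]
  ring

theorem diag_mul_ofReal_im (v : ℝ) :
    (Real.pi * (diag * v) : ℂ).im = Real.pi * (Real.sqrt 2 / 2 * v) := by
  rw [im_ofReal_mul, im_mul_ofReal, diag_im]

theorem sin_diag_ne_zero {v : ℝ} (hv : 0 < v) : sin (Real.pi * (diag * v)) ≠ 0 := by
  have h := abs_sinh_im_le_norm_sin (Real.pi * (diag * v))
  rw [diag_mul_ofReal_im] at h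
  have hpos : 0 < Real.sinh (Real.pi * (Real.sqrt 2 / 2 * v)) :=
    Real.sinh_pos_iff.2 (by positivity)
  rw [abs_of_pos hpos] at h
  exact norm_pos_iff.1 (hpos.trans_le h)

theorem norm_rayKernel_le {v : ℝ} (hv : 0 < v) :
    ‖rayKernel v‖ ≤ Real.exp (-(Real.pi * v ^ 2)) / v := by
  have h := abs_sinh_im_le_norm_sin (Real.pi * (diag * v))
  rw [diag_mul_ofReal_im, Real.abs_sinh] at h
  have h3 := Real.self_le_sinh_iff.2 (abs_nonneg (Real.pi * (Real.sqrt 2 / 2 * v)))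
  rw [abs_of_pos (by positivity)] at h h3
  have hs1 : 1.4 ≤ Real.sqrt 2 := Real.le_sqrt_of_sq_le (by norm_num)
  have h4 : v ≤ Real.pi * (Real.sqrt 2 / 2 * v) := by
    nlinarith [Real.pi_gt_three, mul_pos hv (by positivity : 0 < Real.sqrt 2),
      mul_nonneg hv.le (sub_nonneg.2 hs1)]
  rw [rayKernel, norm_div, norm_exp]
  have : (-(Real.pi * v ^ 2) : ℂ).re = -(Real.pi * v ^ 2) := by
    rw [← ofReal_pow, ← ofReal_mul, ← ofReal_neg, ofReal_re]
  rw [this]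
  gcongr
  linarith

theorem continuousOn_rayKernel : ContinuousOn rayKernel (Ioi 0) := by
  unfold rayKernel
  exact ContinuousOn.div (by fun_prop) (by fun_prop) fun v hv => sin_diag_ne_zero hv

theorem differentiableAt_mellin_rayKernel {w : ℂ} (hw : 1 < w.re) :
    DifferentiableAt ℂ (mellin rayKernel) w := by
  refine mellin_differentiableAt_of_isBigO_rpow_exp (a := 1) (b := 1) one_pos
    (continuousOn_rayKernel.locallyIntegrableOn measurableSet_Ioi) ?_ ?_ hw
  · refine Asymptotics.IsBigO.of_bound 1 ?_
    filter_upwards [eventually_ge_atTop (1 : ℝ)] with v hv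
    rw [one_mul, Real.norm_of_nonneg (Real.exp_pos _).le]
    refine (norm_rayKernel_le (by linarith)).trans ((div_le_self (Real.exp_pos _).le hv).trans ?_)
    rw [Real.exp_le_exp]
    nlinarith [Real.pi_gt_three]
  · refine Asymptotics.IsBigO.of_bound 1 ?_
    filter_upwards [self_mem_nhdsWithin] with v hv
    have hv : 0 < v := hv
    rw [one_mul, Real.rpow_neg_one, norm_inv, Real.norm_of_nonneg hv.le]
    refine (norm_rayKernel_le hv).trans ?_
    rw [inv_eq_one_div]
    gcongr
    rw [Real.exp_le_one_iff]
    have := Real.pi_pos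
    nlinarith [sq_nonneg v]

/-! ### The Gamma integral with a complex rate. -/

theorem ofReal_mul_cpow {r : ℝ} (hr : 0 < r) {x : ℂ} (hx : x ≠ 0) (w : ℂ) :
    ((r : ℂ) * x) ^ w = (r : ℂ) ^ w * x ^ w := by
  have hr' : (r : ℂ) ≠ 0 := ofReal_ne_zero.2 hr.ne'
  rw [cpow_def_of_ne_zero (mul_ne_zero hr' hx), log_ofReal_mul hr hx,
    cpow_def_of_ne_zero hr', cpow_def_of_ne_zero hx, ← exp_add, ofReal_log hr.le]
  ring_nf

theorem integrableOn_rpow_mul_exp {r b : ℝ} (hr : -1 < r) (hb : 0 < b) :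
    IntegrableOn (fun t : ℝ => t ^ r * Real.exp (-(b * t))) (Ioi 0) := by
  have := integrableOn_rpow_mul_exp_neg_mul_rpow (p := 1) hr one_pos hb
  simpa using this

theorem norm_cpow_mul_exp {a w : ℂ} {t : ℝ} (ht : 0 < t) :
    ‖(t : ℂ) ^ (a - 1) * exp (-(w * t))‖ = t ^ (a.re - 1) * Real.exp (-(w.re * t)) := by
  rw [norm_mul, norm_cpow_eq_rpow_re_of_pos ht, norm_exp, neg_re, re_mul_ofReal, sub_re, one_re]

theorem aestronglyMeasurable_cpow_mul_exp (a w : ℂ) :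
    AEStronglyMeasurable (fun t : ℝ => (t : ℂ) ^ (a - 1) * exp (-(w * t)))
      (volume.restrict (Ioi 0)) := by
  refine ContinuousOn.aestronglyMeasurable ?_ measurableSet_Ioi
  refine ContinuousOn.mul (fun t ht => ?_) (by fun_prop)
  exact (continuousAt_ofReal_cpow_const t _ (Or.inr (ne_of_gt ht))).continuousWithinAt

theorem integrableOn_cpow_mul_exp {a w : ℂ} (ha : 0 < a.re) (hw : 0 < w.re) :
    IntegrableOn (fun t : ℝ => (t : ℂ) ^ (a - 1) * exp (-(w * t))) (Ioi 0) := by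
  refine (integrableOn_rpow_mul_exp (r := a.re - 1) (by linarith) hw).mono'
    (aestronglyMeasurable_cpow_mul_exp a w) ?_
  refine (ae_restrict_mem measurableSet_Ioi).mono fun t ht => ?_
  rw [norm_cpow_mul_exp ht]

theorem differentiableAt_integral_cpow_mul_exp {a w : ℂ} (ha : 0 < a.re) (hw : 0 < w.re) :
    DifferentiableAt ℂ
      (fun w : ℂ => ∫ t in Ioi (0 : ℝ), (t : ℂ) ^ (a - 1) * exp (-(w * t))) w := by
  have hε : 0 < w.re / 2 := by linarith
  refine (hasDerivAt_integral_of_dominated_loc_of_deriv_le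
    (F' := fun (z : ℂ) (t : ℝ) => (t : ℂ) ^ (a - 1) * (exp (-(z * t)) * (-t)))
    (bound := fun t => t ^ a.re * Real.exp (-(w.re / 2 * t)))
    (Metric.ball_mem_nhds w hε) (Eventually.of_forall fun z =>
      aestronglyMeasurable_cpow_mul_exp a z) (integrableOn_cpow_mul_exp ha hw) ?_ ?_
      (integrableOn_rpow_mul_exp (by linarith) hε) ?_).2.differentiableAt
  · have := (aestronglyMeasurable_cpow_mul_exp a w).mul
      (Continuous.aestronglyMeasurable (f := fun t : ℝ => (-t : ℂ)) (by fun_prop))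
    exact this.congr (Eventually.of_forall fun t => by simp [mul_assoc])
  · refine (ae_restrict_mem measurableSet_Ioi).mono fun t ht z hz => ?_
    have ht : 0 < t := ht
    rw [← mul_assoc, norm_mul, norm_cpow_mul_exp ht, norm_neg, norm_real,
      Real.norm_of_nonneg ht.le]
    have h1 : t ^ (a.re - 1) * Real.exp (-(z.re * t)) * t =
        t ^ a.re * Real.exp (-(z.re * t)) := by
      rw [Real.rpow_sub_one ht.ne']; field_simp
    rw [h1]
    have h2 : w.re / 2 ≤ z.re := by
      have := (abs_re_le_norm (z - w)).trans (mem_ball_iff_norm.1 hz).le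
      rw [sub_re, abs_le] at this
      linarith [this.1]
    gcongr
  · refine Eventually.of_forall fun t z _ => ?_
    refine HasDerivAt.const_mul _ (HasDerivAt.cexp ?_)
    simpa using (hasDerivAt_mul_const (x := z) (t : ℂ)).fun_neg

/-- Both sides are analytic in w on the right half-plane and agree for w > 0, in particular at the
points 1 + 1/(n+1), which accumulate at 1; the identity theorem does the rest. -/
theorem integral_cpow_mul_exp_neg_complex {a w : ℂ} (ha : 0 < a.re) (hw : 0 < w.re) :
    ∫ t in Ioi (0 : ℝ), (t : ℂ) ^ (a - 1) * exp (-(w * t)) = w ^ (-a) * Gamma a := by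
  set S : Set ℂ := {z | 0 < z.re} with hS
  have hSo : IsOpen S := isOpen_lt continuous_const continuous_re
  have h1 : AnalyticOnNhd ℂ
      (fun w : ℂ => ∫ t in Ioi (0 : ℝ), (t : ℂ) ^ (a - 1) * exp (-(w * t))) S :=
    DifferentiableOn.analyticOnNhd (fun z hz =>
      (differentiableAt_integral_cpow_mul_exp ha hz).differentiableWithinAt) hSo
  have h2 : AnalyticOnNhd ℂ (fun w : ℂ => w ^ (-a) * Gamma a) S := by
    refine DifferentiableOn.analyticOnNhd (fun z hz => ?_) hSo
    have hz' : z ∈ slitPlane := Or.inl hz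
    exact ((hasStrictDerivAt_cpow_const hz').hasDerivAt.differentiableAt.mul_const
      _).differentiableWithinAt
  have hpre : IsPreconnected S := (convex_halfSpace_re_gt 0).isPreconnected
  refine h1.eqOn_of_preconnected_of_frequently_eq h2 hpre (z₀ := 1) (by simp [hS]) ?_ hw
  have ht : Tendsto (fun n : ℕ => (1 : ℂ) + ((1 / ((n : ℝ) + 1) : ℝ) : ℂ)) atTop (𝓝[≠] 1) := by
    rw [tendsto_nhdsWithin_iff]
    constructor
    · have := (continuous_ofReal.tendsto 0).comp (tendsto_one_div_add_atTop_nhds_zero_nat (𝕜 := ℝ))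
      simpa using this.const_add (1 : ℂ)
    · refine Eventually.of_forall fun n => ?_
      simp only [mem_compl_iff, mem_singleton_iff, add_eq_left, ofReal_eq_zero]
      positivity
  refine ht.frequently (Frequently.of_forall fun n => ?_)
  have hr : (0 : ℝ) < 1 + 1 / ((n : ℝ) + 1) := by positivity
  have := integral_cpow_mul_exp_neg_mul_Ioi ha hr
  push_cast at this ⊢
  rw [this, one_div (1 + _), cpow_neg, inv_cpow]
  have e : (1 + 1 / ((n : ℂ) + 1)) = ((1 + 1 / ((n : ℝ) + 1) : ℝ) : ℂ) := by push_cast; rfl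
  rw [e, arg_ofReal_of_nonneg hr.le]
  exact Real.pi_pos.ne

/-! ### From Gaussian Mellin integrals to vertical line integrals. -/

/-- The integral `∫ w^{-l} e^{π w² - 2 π κ w} du` along the vertical line `w = D + i u`. -/
noncomputable def vertInt (l κ : ℂ) (D : ℝ) : ℂ :=
  ∫ u : ℝ, ((D : ℂ) + u * I) ^ (-l) *
    exp (Real.pi * ((D : ℂ) + u * I) ^ 2 - 2 * Real.pi * κ * ((D : ℂ) + u * I))

/-- The Gaussian e^{-π(κ+v)²} equals ∫ e^{πw² - 2π(κ+v)w} du with w = D + iu. After Fubini, the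
v-integral is the Gamma integral of rate 2πw. The left side does not involve D, so independence of
the line comes without a further contour shift. -/
theorem integral_cpow_mul_gaussian {l : ℂ} (hl : 0 < l.re) (κ : ℂ) {D : ℝ} (hD : 0 < D) :
    ∫ v in Ioi (0 : ℝ), (v : ℂ) ^ (l - 1) * exp (-(Real.pi * v ^ 2) - 2 * Real.pi * κ * v) =
      exp (Real.pi * κ ^ 2) * ((2 * Real.pi : ℝ) : ℂ) ^ (-l) * Gamma l * vertInt l κ D := by
  set f : ℝ → ℝ → ℂ := fun u v =>
    exp (Real.pi * ((D : ℂ) + u * I) ^ 2 - 2 * Real.pi * κ * ((D : ℂ) + u * I)) *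
      ((v : ℂ) ^ (l - 1) * exp (-(((2 * Real.pi : ℝ) : ℂ) * ((D : ℂ) + u * I) * v))) with hf
  have hquad : ∀ (c : ℂ) (u : ℝ),
      Real.pi * ((D : ℂ) + u * I) ^ 2 - 2 * Real.pi * c * ((D : ℂ) + u * I) =
        (-Real.pi : ℂ) * u ^ 2 + (2 * Real.pi * (D - c) * I) * u +
          (Real.pi * D ^ 2 - 2 * Real.pi * c * D) := by
    intro c u
    linear_combination (Real.pi * u ^ 2 : ℂ) * I_sq
  have hneg : (-Real.pi : ℂ).re < 0 := by simp [Real.pi_pos]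
  have hg : Integrable (fun u : ℝ =>
      exp (Real.pi * ((D : ℂ) + u * I) ^ 2 - 2 * Real.pi * κ * ((D : ℂ) + u * I))) := by
    simp_rw [hquad κ]
    exact integrable_cexp_quadratic' hneg _ _
  have h2D : 0 < (((2 * Real.pi * D : ℝ) : ℂ)).re := by
    rw [ofReal_re]; positivity
  have hint : Integrable (Function.uncurry f) (volume.prod (volume.restrict (Ioi 0))) := by
    have hm := hg.mul_prod (integrableOn_cpow_mul_exp hl h2D)
    -- The variables couple only through e^{-2πiuv}, of modulus 1, so joint integrability is that of
    -- a product.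
    have hb := hm.bdd_mul (c := 1) (f := fun z : ℝ × ℝ =>
      exp (((-(2 * Real.pi * z.1 * z.2) : ℝ) : ℂ) * I))
      (Continuous.aestronglyMeasurable (by fun_prop))
      (Eventually.of_forall fun z => (norm_exp_ofReal_mul_I _).le)
    refine hb.congr (Eventually.of_forall fun z => ?_)
    simp only [Function.uncurry, hf]
    have : exp (-(((2 * Real.pi : ℝ) : ℂ) * ((D : ℂ) + z.1 * I) * z.2)) =
        exp (((-(2 * Real.pi * z.1 * z.2) : ℝ) : ℂ) * I) *
          exp (-(((2 * Real.pi * D : ℝ) : ℂ) * z.2)) := by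
      rw [← exp_add]; push_cast; ring_nf
    rw [this]
    ring
  have hswap := integral_integral_swap hint
  have hL : ∫ u : ℝ, ∫ v in Ioi (0 : ℝ), f u v =
      ((2 * Real.pi : ℝ) : ℂ) ^ (-l) * Gamma l * vertInt l κ D := by
    rw [vertInt, ← integral_const_mul]
    refine integral_congr_ae (Eventually.of_forall fun u => ?_)
    simp only [hf]
    have hne : (D : ℂ) + u * I ≠ 0 := by
      intro h
      have := congrArg re h
      simp at this
      exact hD.ne' this
    have hre : 0 < (((2 * Real.pi : ℝ) : ℂ) * ((D : ℂ) + u * I)).re := by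
      rw [re_ofReal_mul]
      simp
      positivity
    rw [integral_const_mul, integral_cpow_mul_exp_neg_complex hl hre,
      ofReal_mul_cpow (by positivity) hne]
    ring
  have hRt : ∫ v in Ioi (0 : ℝ), ∫ u : ℝ, f u v = exp (-(Real.pi * κ ^ 2)) *
      ∫ v in Ioi (0 : ℝ), (v : ℂ) ^ (l - 1) *
        exp (-(Real.pi * v ^ 2) - 2 * Real.pi * κ * v) := by
    rw [← integral_const_mul]
    refine integral_congr_ae (Eventually.of_forall fun v => ?_)
    simp only [hf]
    have e : ∀ u : ℝ,
        exp (Real.pi * ((D : ℂ) + u * I) ^ 2 - 2 * Real.pi * κ * ((D : ℂ) + u * I)) *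
        ((v : ℂ) ^ (l - 1) * exp (-(((2 * Real.pi : ℝ) : ℂ) * ((D : ℂ) + u * I) * v))) =
        (v : ℂ) ^ (l - 1) * exp ((-Real.pi : ℂ) * u ^ 2 + (2 * Real.pi * (D - (κ + v)) * I) * u +
          (Real.pi * D ^ 2 - 2 * Real.pi * (κ + v) * D)) := by
      intro u
      rw [← hquad (κ + v) u, mul_left_comm, ← exp_add]
      push_cast
      ring_nf
    have hpi : (Real.pi : ℂ) ≠ 0 := by exact_mod_cast Real.pi_ne_zero
    simp_rw [e]
    rw [integral_const_mul, integral_cexp_quadratic hneg, neg_neg, div_self hpi, one_cpow, one_mul,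
      mul_left_comm, ← exp_add]
    congr 2
    field_simp
    linear_combination (4 * (D - (κ + v)) ^ 2 : ℂ) * I_sq
  rw [hL, hRt] at hswap
  have hee : exp (Real.pi * κ ^ 2) * exp (-(Real.pi * κ ^ 2)) = 1 := by
    rw [← exp_add, add_neg_cancel, exp_zero]
  have h := congrArg (fun z => exp (Real.pi * κ ^ 2) * z) hswap
  rw [← mul_assoc (exp _) (exp _), hee, one_mul] at h
  rw [← h]
  ring

/-! ### Expansion of the kernel in a series. -/

/-- The rotated frequency `K e^{-π i / 4}`. -/
noncomputable def kap (K : ℝ) : ℂ := K / diag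

theorem inv_diag : diag⁻¹ = -(I * diag) := by
  have h : diag * -(I * diag) = 1 := by
    have : diag * -(I * diag) = -(I * diag ^ 2) := by ring
    rw [this, diag_sq, I_mul_I, neg_neg]
  exact inv_eq_of_mul_eq_one_right h

theorem kap_eq (K : ℝ) : kap K = -(K * (I * diag)) := by
  rw [kap, div_eq_mul_inv, inv_diag]; ring

theorem kap_re (K : ℝ) : (kap K).re = Real.sqrt 2 / 2 * K := by
  rw [kap_eq]; simp [diag_im]; ring

theorem kap_im (K : ℝ) : (kap K).im = -(Real.sqrt 2 / 2 * K) := by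
  rw [kap_eq]; simp [diag_re]; ring

theorem kap_sq (K : ℝ) : kap K ^ 2 = -(I * K ^ 2) := by
  rw [kap, div_pow, diag_sq, div_I]
  ring

/-- Since (k + 1/2)² = k(k+1) + 1/4 and k(k+1) is even, the value does not depend on k. All terms of
the series therefore share one constant. -/
theorem exp_pi_mul_kap_sq (k : ℕ) : exp (Real.pi * kap (k + 1 / 2) ^ 2) = diag⁻¹ := by
  have h : (Real.pi * kap (k + 1 / 2) ^ 2 : ℂ) =
      -(((k * (k + 1) / 2 : ℕ) : ℂ) * (2 * Real.pi * I)) - Real.pi * I / 4 := by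
    have h2 : ((k * (k + 1) / 2 : ℕ) : ℂ) = (k * (k + 1) : ℂ) / 2 := by
      rw [Nat.cast_div (Nat.even_mul_succ_self k).two_dvd (by norm_num)]
      push_cast
      rfl
    rw [kap_sq, h2]
    push_cast
    ring
  rw [h, exp_sub, exp_neg, exp_nat_mul_two_pi_mul_I, diag]
  simp

theorem hasSum_exp_kap {v : ℝ} (hv : 0 < v) :
    HasSum (fun k : ℕ => exp (-(2 * Real.pi * kap (k + 1 / 2) * v)))
      (I / (2 * sin (Real.pi * (diag * v)))) := by
  set x : ℂ := Real.pi * (diag * v) with hx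
  have him : 0 < x.im := by rw [hx, diag_mul_ofReal_im]; positivity
  have hlt : ‖exp (2 * x * I)‖ < 1 := by
    rw [norm_exp, Real.exp_lt_one_iff]
    simp
    linarith
  have hg := (hasSum_geometric_of_norm_lt_one hlt).mul_left (exp (x * I))
  have hterm : (fun k : ℕ => exp (-(2 * Real.pi * kap (k + 1 / 2) * v))) =
      fun k : ℕ => exp (x * I) * exp (2 * x * I) ^ k := by
    ext k
    rw [← exp_nat_mul, ← exp_add, kap_eq, hx]
    congr 1
    push_cast
    ring
  have hval : I / (2 * sin x) = exp (x * I) * (1 - exp (2 * x * I))⁻¹ := by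
    have hsin : sin x ≠ 0 := sin_diag_ne_zero hv
    have h1 : 1 - exp (2 * x * I) ≠ 0 := by
      intro h
      rw [← sub_eq_zero.1 h] at hlt
      simp at hlt
    have h2 : exp (x * I) * exp (-x * I) = 1 := by
      rw [← exp_add]; simp
    have h3 : exp (2 * x * I) = exp (x * I) * exp (x * I) := by
      rw [← exp_add]; ring_nf
    rw [← div_eq_mul_inv, div_eq_div_iff (by simpa using hsin) h1, Complex.sin, h3]
    linear_combination (-I) * h2
  rw [hterm, hval]
  exact hg

/-- Termwise integration is justified because the k-th absolute integral is at most Γ(Re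
l)/(k+1)^{Re l}, which is where Re l > 1 enters. Each term keeps its own abscissa `D k`, to be
placed at a saddle later. -/
theorem mellin_rayKernel_eq {l : ℂ} (hl : 1 < l.re) (D : ℕ → ℝ) (hD : ∀ k, 0 < D k) :
    Summable (fun k : ℕ => vertInt l (kap (k + 1 / 2)) (D k)) ∧
    mellin rayKernel l = -(2 * I) * diag⁻¹ * ((2 * Real.pi : ℝ) : ℂ) ^ (-l) * Gamma l *
      ∑' k : ℕ, vertInt l (kap (k + 1 / 2)) (D k) := by
  have hl0 : 0 < l.re := by linarith
  set F : ℕ → ℝ → ℂ := fun k v =>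
    (v : ℂ) ^ (l - 1) * exp (-(Real.pi * v ^ 2) - 2 * Real.pi * kap (k + 1 / 2) * v) with hF
  have hmeas : ∀ k, AEStronglyMeasurable (F k) (volume.restrict (Ioi 0)) := by
    intro k
    refine ContinuousOn.aestronglyMeasurable ?_ measurableSet_Ioi
    refine ContinuousOn.mul (fun t ht => ?_) (by fun_prop)
    exact (continuousAt_ofReal_cpow_const t _ (Or.inr (ne_of_gt ht))).continuousWithinAt
  have hbound : ∀ k : ℕ, ∀ v ∈ Ioi (0 : ℝ),
      ‖F k v‖ ≤ v ^ (l.re - 1) * Real.exp (-(((k : ℝ) + 1) * v)) := by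
    intro k v hv
    have hv : 0 < v := hv
    simp only [hF]
    rw [norm_mul, norm_cpow_eq_rpow_re_of_pos hv, norm_exp, sub_re, one_re]
    gcongr
    have e : (-(Real.pi * v ^ 2) - 2 * Real.pi * kap (k + 1 / 2) * v : ℂ) =
        ((-(Real.pi * v ^ 2) : ℝ) : ℂ) - ((2 * Real.pi * v : ℝ) : ℂ) * kap (k + 1 / 2) := by
      push_cast; ring
    rw [e, sub_re, ofReal_re, re_ofReal_mul, kap_re]
    have hs1 : 1.4 ≤ Real.sqrt 2 := Real.le_sqrt_of_sq_le (by norm_num)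
    have hp := Real.pi_gt_three
    have h4 : (4.2 : ℝ) ≤ Real.pi * Real.sqrt 2 := by nlinarith
    have hk : (0 : ℝ) ≤ k := Nat.cast_nonneg k
    have h5 : (k : ℝ) + 1 ≤ Real.pi * Real.sqrt 2 * (k + 1 / 2) := by nlinarith
    have h6 := mul_le_mul_of_nonneg_right h5 hv.le
    have h7 : 0 ≤ Real.pi * v ^ 2 := by positivity
    linarith
  have hint : ∀ k, Integrable (F k) (volume.restrict (Ioi 0)) := by
    intro k
    refine (integrableOn_rpow_mul_exp (r := l.re - 1) (b := (k : ℝ) + 1) (by linarith)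
      (by positivity)).mono' (hmeas k) ?_
    exact (ae_restrict_mem measurableSet_Ioi).mono (hbound k)
  have hsum : Summable fun k => ∫ v in Ioi (0 : ℝ), ‖F k v‖ := by
    have hs : Summable fun k : ℕ => 1 / ((k : ℝ) + 1) ^ l.re * Real.Gamma l.re := by
      refine Summable.mul_right _ ?_
      have := (summable_nat_add_iff 1).2 (Real.summable_one_div_nat_rpow.2 hl)
      simpa using this
    refine hs.of_nonneg_of_le (fun k => integral_nonneg fun _ => norm_nonneg _) fun k => ?_
    have hk : (0 : ℝ) < (k : ℝ) + 1 := by positivity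
    calc ∫ v in Ioi (0 : ℝ), ‖F k v‖
        ≤ ∫ v in Ioi (0 : ℝ), v ^ (l.re - 1) * Real.exp (-(((k : ℝ) + 1) * v)) :=
          setIntegral_mono_on (hint k).norm (integrableOn_rpow_mul_exp (by linarith) hk)
            measurableSet_Ioi (hbound k)
      _ = _ := by
          rw [Real.integral_rpow_mul_exp_neg_mul_Ioi hl0 hk, Real.div_rpow zero_le_one hk.le,
            Real.one_rpow]
  have hmain := hasSum_integral_of_summable_integral_norm hint hsum
  have hlhs : ∀ k : ℕ, ∫ v in Ioi (0 : ℝ), F k v =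
      (diag⁻¹ * ((2 * Real.pi : ℝ) : ℂ) ^ (-l) * Gamma l) * vertInt l (kap (k + 1 / 2)) (D k) := by
    intro k
    rw [← exp_pi_mul_kap_sq k]
    exact integral_cpow_mul_gaussian hl0 _ (hD k)
  have hrhs : ∫ v in Ioi (0 : ℝ), ∑' k, F k v = I / 2 * mellin rayKernel l := by
    rw [mellin, ← integral_const_mul]
    refine setIntegral_congr_fun measurableSet_Ioi fun v hv => ?_
    simp only [hF, smul_eq_mul, rayKernel]
    have h := ((hasSum_exp_kap hv).mul_left
      ((v : ℂ) ^ (l - 1) * exp (-(Real.pi * v ^ 2)))).tsum_eq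
    rw [show I / 2 * ((v : ℂ) ^ (l - 1) *
      (exp (-(Real.pi * v ^ 2)) / sin (Real.pi * (diag * v)))) =
      (v : ℂ) ^ (l - 1) * exp (-(Real.pi * v ^ 2)) * (I / (2 * sin (Real.pi * (diag * v)))) by
        rw [← div_div]; ring, ← h]
    refine tsum_congr fun k => ?_
    rw [mul_assoc ((v : ℂ) ^ (l - 1)), ← exp_add, ← sub_eq_add_neg]
  simp_rw [hlhs] at hmain
  rw [hrhs] at hmain
  have hpi : ((2 * Real.pi : ℝ) : ℂ) ≠ 0 := by
    exact_mod_cast (by positivity : (2 * Real.pi : ℝ) ≠ 0)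
  -- Nonvanishing of the common constant lets summability pass to the line integrals themselves.
  have hC : diag⁻¹ * ((2 * Real.pi : ℝ) : ℂ) ^ (-l) * Gamma l ≠ 0 := by
    refine mul_ne_zero (mul_ne_zero (inv_ne_zero diag_ne_zero) ?_) (Gamma_ne_zero_of_re_pos hl0)
    rw [Ne, cpow_eq_zero_iff]
    exact fun h => hpi h.1
  have hS : Summable (fun k : ℕ => vertInt l (kap (k + 1 / 2)) (D k)) :=
    (summable_mul_left_iff hC).1 hmain.summable
  refine ⟨hS, ?_⟩
  have h := hmain.tsum_eq
  rw [tsum_mul_left] at h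
  linear_combination (2 * I) * h + mellin rayKernel l * I_sq

/-! ### Gaussian decay on vertical lines through a saddle point. -/

theorem le_apply_zero_of_deriv_eq_neg_mul {f c : ℝ → ℝ}
    (hf : ∀ v, HasDerivAt f (-(v * c v)) v) (hc : ∀ v, 0 ≤ c v) (v : ℝ) : f v ≤ f 0 := by
  have hcont : Continuous f := continuous_iff_continuousAt.2 fun v => (hf v).continuousAt
  have hdiff : Differentiable ℝ f := fun v => (hf v).differentiableAt
  rcases le_total 0 v with hv | hv
  · refine antitoneOn_of_deriv_nonpos (convex_Ici (0 : ℝ)) hcont.continuousOn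
      hdiff.differentiableOn ?_ self_mem_Ici hv hv
    intro x hx
    rw [interior_Ici, mem_Ioi] at hx
    rw [(hf x).deriv]
    have := mul_nonneg hx.le (hc x)
    linarith
  · refine monotoneOn_of_deriv_nonneg (convex_Iic (0 : ℝ)) hcont.continuousOn
      hdiff.differentiableOn ?_ hv self_mem_Iic hv
    intro x hx
    rw [interior_Iic, mem_Iio] at hx
    rw [(hf x).deriv]
    have := mul_nonneg (neg_nonneg.2 hx.le) (hc x)
    linarith

/-- The exponent of the integrand of `vertInt`. -/
noncomputable def phase (l κ w : ℂ) : ℂ := -l * log w + Real.pi * w ^ 2 - 2 * Real.pi * κ * w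

theorem exp_phase {w : ℂ} (hw : w ≠ 0) (l κ : ℂ) :
    exp (phase l κ w) = w ^ (-l) * exp (Real.pi * w ^ 2 - 2 * Real.pi * κ * w) := by
  rw [cpow_def_of_ne_zero hw, ← exp_add, phase]
  ring_nf

theorem vertInt_eq {w₀ : ℂ} (hw : 0 < w₀.re) (l κ : ℂ) :
    vertInt l κ w₀.re = ∫ v : ℝ, exp (phase l κ (w₀ + v * I)) := by
  rw [vertInt, ← integral_add_right_eq_self (μ := volume) _ w₀.im]
  refine integral_congr_ae (Eventually.of_forall fun v => ?_)
  simp only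
  have e : (w₀.re : ℂ) + ((v + w₀.im : ℝ) : ℂ) * I = w₀ + v * I := by
    conv_rhs => rw [← re_add_im w₀]
    push_cast
    ring
  have hne : w₀ + v * I ≠ 0 := by
    intro h
    have := congrArg re h
    simp at this
    exact hw.ne' this
  rw [e, exp_phase hne]

theorem hasDerivAt_line (w₀ : ℂ) (v : ℝ) : HasDerivAt (fun v : ℝ => w₀ + v * I) I v := by
  simpa using ((hasDerivAt_id v).ofReal_comp.mul_const I).const_add w₀

theorem line_mem_slitPlane {w₀ : ℂ} (hw : 0 < w₀.re) (v : ℝ) : w₀ + v * I ∈ slitPlane := by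
  left; simpa using hw

/-- The saddle equation is w² - κw - l/(2π) = 0. Parametrizing by its roots w₀ and -m gives κ = w₀ -
m and l = 2πw₀m, and the derivative factors through (w - w₀)(w + m)/w. -/
theorem hasDerivAt_phase_line {w₀ : ℂ} (hw : 0 < w₀.re) (m : ℂ) (v : ℝ) :
    HasDerivAt (fun v : ℝ => phase (2 * Real.pi * (w₀ * m)) (w₀ - m) (w₀ + v * I))
      (-(2 * Real.pi * v) * (1 + m / (w₀ + v * I))) v := by
  have hl := hasDerivAt_line w₀ v
  have hs := line_mem_slitPlane hw v
  have hne := slitPlane_ne_zero hs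
  have h := (((hl.clog_real hs).const_mul (-(2 * Real.pi * (w₀ * m)))).add
    ((hl.pow 2).const_mul (Real.pi : ℂ))).sub (hl.const_mul (2 * Real.pi * (w₀ - m)))
  refine HasDerivAt.congr_deriv h ?_
  have hvI : (v : ℂ) * I = (w₀ + v * I) - w₀ := by ring
  generalize w₀ + v * I = w at hvI hne ⊢
  rw [Nat.add_one_sub_one, pow_one]
  field_simp
  push_cast
  linear_combination (2 * v * (w + m)) * I_sq - (2 * I * (w + m)) * hvI

/-- On a vertical line through the saddle point `w₀` the integrand decays at least like a Gaussian,
provided the other saddle point `-m` does not interfere. -/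
theorem norm_exp_phase_line_le {w₀ m : ℂ} (hw : 0 < w₀.re) {c : ℝ}
    (hm : ∀ v : ℝ, -(1 - c) ≤ (m / (w₀ + v * I)).re) (v : ℝ) :
    ‖exp (phase (2 * Real.pi * (w₀ * m)) (w₀ - m) (w₀ + v * I))‖ ≤
      ‖exp (phase (2 * Real.pi * (w₀ * m)) (w₀ - m) w₀)‖ * Real.exp (-(c * Real.pi) * v ^ 2) := by
  set f : ℝ → ℝ := fun v => (phase (2 * Real.pi * (w₀ * m)) (w₀ - m) (w₀ + v * I)).re +
    c * Real.pi * v ^ 2 with hf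
  have hder : ∀ v : ℝ, HasDerivAt f
      (-(v * (2 * Real.pi * ((1 - c) + (m / (w₀ + v * I)).re)))) v := by
    intro v
    have h1 := (hasDerivAt_phase_line hw m v)
    have h2 : HasDerivAt (fun v : ℝ =>
      (phase (2 * Real.pi * (w₀ * m)) (w₀ - m) (w₀ + v * I)).re)
      (-(2 * Real.pi * v) * (1 + m / (w₀ + v * I)) : ℂ).re v :=
      reCLM.hasFDerivAt.comp_hasDerivAt v h1
    have h3 := h2.add (((hasDerivAt_id v).pow 2).const_mul (c * Real.pi))
    refine HasDerivAt.congr_deriv h3 ?_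
    have e : (-(2 * Real.pi * v) * (1 + m / (w₀ + v * I)) : ℂ).re =
        -(2 * Real.pi * v) * (1 + (m / (w₀ + v * I)).re) := by
      rw [show (-(2 * Real.pi * v) : ℂ) = ((-(2 * Real.pi * v) : ℝ) : ℂ) by push_cast; rfl,
        re_ofReal_mul, add_re, one_re]
    rw [e]
    simp
    ring
  have h := le_apply_zero_of_deriv_eq_neg_mul hder (fun v => by
    have := hm v
    have hp := Real.pi_pos
    exact mul_nonneg (by positivity) (by linarith)) v
  rw [norm_exp, norm_exp, ← Real.exp_add, Real.exp_le_exp]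
  simp only [hf, ofReal_zero, zero_mul, add_zero] at h
  norm_num at h
  linarith

/-- Inversion maps the line Re w = r into the circle with centre and radius 1/(2r), so Re(m/w) is at
least (Re m - |m|)/(2r). -/
theorem re_div_line_ge {w₀ m : ℂ} (hw : 0 < w₀.re) {c : ℝ}
    (h : ‖m‖ - m.re ≤ 2 * (1 - c) * w₀.re) (v : ℝ) : -(1 - c) ≤ (m / (w₀ + v * I)).re := by
  set w := w₀ + v * I with hwdef
  have hre : w.re = w₀.re := by simp [hwdef]
  rw [← hre] at h hw
  have hN : 0 < normSq w := by
    rw [normSq_apply]; nlinarith [mul_self_nonneg w.im]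
  rw [div_re, ← add_div, le_div_iff₀ hN, normSq_apply]
  have hm2 : m.re ^ 2 + m.im ^ 2 = ‖m‖ ^ 2 := by
    rw [← normSq_eq_norm_sq, normSq_apply]; ring
  have hc : 0 ≤ 2 * (1 - c) * w.re := by
    have := re_le_norm m
    linarith
  have hc' : 0 ≤ 1 - c := by
    by_contra hneg
    push Not at hneg
    nlinarith
  have hM := norm_nonneg m
  have h1 : -(‖m‖ * (w.re * w.re + w.im * w.im)) ≤
      m.re * (w.re ^ 2 - w.im ^ 2) + 2 * (m.im * (w.re * w.im)) := by
    have hsq : (m.re * (w.re ^ 2 - w.im ^ 2) + 2 * (m.im * (w.re * w.im))) ^ 2 ≤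
        (‖m‖ * (w.re * w.re + w.im * w.im)) ^ 2 := by
      have : (‖m‖ * (w.re * w.re + w.im * w.im)) ^ 2 =
          (m.re ^ 2 + m.im ^ 2) * (w.re * w.re + w.im * w.im) ^ 2 := by rw [hm2]; ring
      rw [this]
      nlinarith [sq_nonneg (m.im * (w.re ^ 2 - w.im ^ 2) - 2 * (m.re * (w.re * w.im)))]
    exact (abs_le.1 (abs_le_of_sq_le_sq hsq (by positivity))).1
  have h2 := mul_le_mul_of_nonneg_right h (by positivity : 0 ≤ w.re * w.re + w.im * w.im)
  nlinarith

theorem norm_vertInt_le {w₀ m : ℂ} (hw : 0 < w₀.re)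
    (h : ‖m‖ - m.re ≤ 3 / 2 * w₀.re) :
    ‖vertInt (2 * Real.pi * (w₀ * m)) (w₀ - m) w₀.re‖ ≤
      2 * ‖exp (phase (2 * Real.pi * (w₀ * m)) (w₀ - m) w₀)‖ := by
  rw [vertInt_eq hw]
  -- The decay rate c = 1/4 matches the hypothesis, as 2(1 - c) = 3/2; the resulting Gaussian has
  -- integral √4 = 2.
  have hb : 0 < 1 / 4 * Real.pi := by positivity
  have hm := re_div_line_ge (m := m) (c := 1 / 4) hw (by linarith)
  refine (norm_integral_le_of_norm_le ((integrable_exp_neg_mul_sq hb).const_mul _)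
    (Eventually.of_forall fun v => norm_exp_phase_line_le hw hm v)).trans ?_
  rw [integral_const_mul, integral_gaussian]
  have : Real.pi / (1 / 4 * Real.pi) = 2 ^ 2 := by
    field_simp; norm_num
  rw [this, Real.sqrt_sq (by norm_num), mul_comm]

/-! ### The saddle points as functions of K. -/

/-- The root of `z ^ 2 = K ^ 2 + 4 η ^ 2` in the right half-plane. -/
noncomputable def discRoot (η : ℂ) (K : ℝ) : ℂ := ((K : ℂ) ^ 2 + 4 * η ^ 2) ^ (1 / 2 : ℂ)

/-- The saddle point of `w ↦ phase l (kap K) w` in the right half-plane, where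
`l = 2 π (η / e^{π i / 4})²`. -/
noncomputable def saddle (η : ℂ) (K : ℝ) : ℂ := (K + discRoot η K) / (2 * diag)

/-- The negative of the second saddle point of `w ↦ phase l (kap K) w`. -/
noncomputable def coSaddle (η : ℂ) (K : ℝ) : ℂ := (discRoot η K - K) / (2 * diag)

theorem discRoot_sq (η : ℂ) (K : ℝ) : discRoot η K ^ 2 = K ^ 2 + 4 * η ^ 2 := by
  rw [discRoot, ← cpow_nat_mul]; norm_num

theorem re_cpow_half_pos {z : ℂ} (hz : z ∈ slitPlane) : 0 < (z ^ (1 / 2 : ℂ)).re := by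
  rw [cpow_def_of_ne_zero (slitPlane_ne_zero hz), exp_re]
  have him : (log z * (1 / 2)).im = z.arg / 2 := by
    rw [show log z * (1 / 2) = ((1 / 2 : ℝ) : ℂ) * log z by push_cast; ring, im_ofReal_mul, log_im]
    ring
  rw [him]
  have h1 := neg_pi_lt_arg z
  have h2 := lt_of_le_of_ne (arg_le_pi z) (mem_slitPlane_iff_arg.1 hz).1
  exact mul_pos (Real.exp_pos _) (Real.cos_pos_of_mem_Ioo ⟨by linarith, by linarith⟩)

theorem disc_mem_slitPlane {η : ℂ} (ha : 0 < η.re) (hb : 0 < η.im) (K : ℝ) :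
    (K : ℂ) ^ 2 + 4 * η ^ 2 ∈ slitPlane := by
  right
  have : ((K : ℂ) ^ 2 + 4 * η ^ 2).im = 8 * (η.re * η.im) := by
    simp [pow_two]; ring
  rw [this]
  positivity

theorem discRoot_re_pos {η : ℂ} (ha : 0 < η.re) (hb : 0 < η.im) (K : ℝ) :
    0 < (discRoot η K).re :=
  re_cpow_half_pos (disc_mem_slitPlane ha hb K)

theorem discRoot_re_mul_im (η : ℂ) (K : ℝ) :
    (discRoot η K).re * (discRoot η K).im = 4 * (η.re * η.im) := by
  have h := congrArg im (discRoot_sq η K)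
  simp [pow_two] at h
  linarith

theorem discRoot_re_sq_sub (η : ℂ) (K : ℝ) :
    (discRoot η K).re ^ 2 - (discRoot η K).im ^ 2 = K ^ 2 + 4 * (η.re ^ 2 - η.im ^ 2) := by
  have h := congrArg re (discRoot_sq η K)
  simp [pow_two] at h
  linarith

theorem discRoot_im_pos {η : ℂ} (ha : 0 < η.re) (hb : 0 < η.im) (K : ℝ) :
    0 < (discRoot η K).im := by
  have h := discRoot_re_mul_im η K
  have h2 : 0 < (discRoot η K).re * (discRoot η K).im := by rw [h]; positivity
  exact (mul_pos_iff_of_pos_left (discRoot_re_pos ha hb K)).1 h2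

/-- For the root x + iy one has xy = 4ab with η = a + ib, so the claim says x ≤ K + 2a. Otherwise y
< 2b, and x² - y² would exceed K² + 4(a² - b²). -/
theorem discRoot_im_ge {η : ℂ} (ha : 0 < η.re) (hb : 0 < η.im) {K : ℝ} (hK : 0 ≤ K) :
    4 * (η.re * η.im) / (K + 2 * η.re) ≤ (discRoot η K).im := by
  have h1 := discRoot_re_mul_im η K
  have h2 := discRoot_re_sq_sub η K
  have h3 := discRoot_re_pos ha hb K
  have h4 := discRoot_im_pos ha hb K
  rw [div_le_iff₀ (by positivity), ← h1, mul_comm]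
  refine mul_le_mul_of_nonneg_left ?_ h4.le
  by_contra hlt
  push Not at hlt
  have h5 : (discRoot η K).im < 2 * η.im := by
    by_contra h6
    push Not at h6
    nlinarith [mul_le_mul_of_nonneg_left h6 h3.le, mul_pos ha hb, mul_nonneg hK hb.le]
  nlinarith [mul_nonneg hK ha.le]

theorem discRoot_zero {η : ℂ} (ha : 0 < η.re) (hb : 0 < η.im) : discRoot η 0 = 2 * η := by
  have h := discRoot_sq η 0
  have h2 : (discRoot η 0 - 2 * η) * (discRoot η 0 + 2 * η) = 0 := by
    push_cast at h
    linear_combination h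
  rcases mul_eq_zero.1 h2 with h3 | h3
  · exact sub_eq_zero.1 h3
  · have h4 := congrArg re h3
    have h5 := discRoot_re_pos ha hb 0
    simp at h4
    linarith

theorem saddle_zero {η : ℂ} (ha : 0 < η.re) (hb : 0 < η.im) : saddle η 0 = η / diag := by
  rw [saddle, discRoot_zero ha hb]
  have := diag_ne_zero
  push_cast
  field_simp
  ring

theorem saddle_sub_coSaddle (η : ℂ) (K : ℝ) : saddle η K - coSaddle η K = kap K := by
  rw [saddle, coSaddle, kap]
  have := diag_ne_zero
  field_simp
  ring

theorem saddle_mul_coSaddle (η : ℂ) (K : ℝ) : saddle η K * coSaddle η K = (η / diag) ^ 2 := by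
  have h := discRoot_sq η K
  rw [saddle, coSaddle]
  have := diag_ne_zero
  field_simp
  linear_combination h

theorem div_diag_re (z : ℂ) : (z / diag).re = Real.sqrt 2 / 2 * (z.re + z.im) := by
  rw [div_eq_mul_inv, inv_diag]
  simp [diag_re, diag_im]
  ring

theorem div_diag_im (z : ℂ) : (z / diag).im = Real.sqrt 2 / 2 * (z.im - z.re) := by
  rw [div_eq_mul_inv, inv_diag]
  simp [diag_re, diag_im]
  ring

theorem saddle_re (η : ℂ) (K : ℝ) :
    (saddle η K).re = Real.sqrt 2 / 4 * (K + (discRoot η K).re + (discRoot η K).im) := by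
  have : saddle η K = ((1 / 2 : ℝ) : ℂ) * ((K + discRoot η K) / diag) := by
    rw [saddle]; push_cast; field_simp
  rw [this, re_ofReal_mul, div_diag_re]
  simp
  ring

theorem coSaddle_re (η : ℂ) (K : ℝ) :
    (coSaddle η K).re = Real.sqrt 2 / 4 * ((discRoot η K).re - K + (discRoot η K).im) := by
  have : coSaddle η K = ((1 / 2 : ℝ) : ℂ) * ((discRoot η K - K) / diag) := by
    rw [coSaddle]; push_cast; field_simp
  rw [this, re_ofReal_mul, div_diag_re]
  simp
  ring

theorem saddle_re_pos {η : ℂ} (ha : 0 < η.re) (hb : 0 < η.im) {K : ℝ} (hK : 0 ≤ K) :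
    0 < (saddle η K).re := by
  have h3 := discRoot_re_pos ha hb K
  have h4 := discRoot_im_pos ha hb K
  rw [saddle_re]
  positivity

/-- This is the hypothesis of `norm_vertInt_le` at the true saddles. The angle condition b ≤ 10a
gives b² - a² ≤ 9.9ab, hence K² ≤ x² - y² + 9.9xy for the root x + iy; the rest is a quadratic
inequality in x, y, K. -/
theorem norm_coSaddle_sub_re_le {η : ℂ} (ha : 0 < η.re) (hb : 0 < η.im)
    (hab : η.im ≤ 10 * η.re) {K : ℝ} (hK : 0 ≤ K) :
    ‖coSaddle η K‖ - (coSaddle η K).re ≤ 3 / 2 * (saddle η K).re := by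
  have h1 := discRoot_re_mul_im η K
  have h2 := discRoot_re_sq_sub η K
  have h3 := discRoot_re_pos ha hb K
  have h4 := discRoot_im_pos ha hb K
  have hn : ‖coSaddle η K‖ = ‖discRoot η K - K‖ / 2 := by
    rw [coSaddle, norm_div, norm_mul, norm_diag]; simp
  rw [hn, saddle_re, coSaddle_re]
  set x := (discRoot η K).re
  set y := (discRoot η K).im
  have hs2 : Real.sqrt 2 ^ 2 = 2 := Real.sq_sqrt (by norm_num)
  have hN : ‖discRoot η K - K‖ ≤ Real.sqrt 2 * ((5 * x + K + 5 * y) / 4) := by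
    refine abs_le_of_sq_le_sq' ?_ (by positivity) |>.2
    rw [← normSq_eq_norm_sq, normSq_apply, mul_pow, hs2]
    simp only [sub_re, sub_im, ofReal_re, ofReal_im, sub_zero]
    have h5 : η.im ^ 2 - η.re ^ 2 ≤ 9.9 * (η.re * η.im) := by
      nlinarith [mul_nonneg (sub_nonneg.2 hab) (by positivity : 0 ≤ η.im + 0.1 * η.re)]
    have h6 : K ^ 2 ≤ x ^ 2 - y ^ 2 + 9.9 * (x * y) := by linarith
    nlinarith [mul_nonneg h3.le hK, mul_nonneg h4.le hK, sq_nonneg (x - y), mul_pos h3 h4,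
      sq_nonneg x, sq_nonneg y]
  nlinarith

theorem hasDerivAt_saddle {η : ℂ} (ha : 0 < η.re) (hb : 0 < η.im) (K : ℝ) :
    ∃ W' : ℂ, HasDerivAt (saddle η) W' K := by
  have h1 : DifferentiableAt ℂ (fun z : ℂ => (z + (z ^ 2 + 4 * η ^ 2) ^ (1 / 2 : ℂ)) / (2 * diag))
      (K : ℂ) := by
    have h2 : DifferentiableAt ℂ (fun z : ℂ => (z ^ 2 + 4 * η ^ 2) ^ (1 / 2 : ℂ)) (K : ℂ) :=
      DifferentiableAt.cpow_const (by fun_prop) (disc_mem_slitPlane ha hb K)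
    exact (differentiableAt_id.add h2).div_const _
  exact ⟨_, h1.hasDerivAt.comp_ofReal⟩

/-- At a critical point the motion of the saddle does not contribute, so only the explicit
dependence on κ = K e^{-πi/4} is differentiated. -/
theorem hasDerivAt_phase_saddle {η : ℂ} (ha : 0 < η.re) (hb : 0 < η.im) {K : ℝ} (hK : 0 ≤ K) :
    HasDerivAt (fun K : ℝ =>
      (phase (2 * Real.pi * (η / diag) ^ 2) (kap K) (saddle η K)).re)
      (-(Real.pi * (discRoot η K).im)) K := by
  obtain ⟨W', hW⟩ := hasDerivAt_saddle ha hb K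
  have hs : saddle η K ∈ slitPlane := Or.inl (saddle_re_pos ha hb hK)
  have hne := slitPlane_ne_zero hs
  have hk : HasDerivAt kap (((1 : ℝ) : ℂ) / diag) K := by
    exact (hasDerivAt_id K).ofReal_comp.div_const diag
  have h := (((hW.clog_real hs).const_mul (-(2 * Real.pi * (η / diag) ^ 2))).add
    ((hW.pow 2).const_mul (Real.pi : ℂ))).sub
    ((hk.const_mul (2 * Real.pi : ℂ)).mul hW)
  have hre : HasDerivAt (fun K : ℝ =>
      (phase (2 * Real.pi * (η / diag) ^ 2) (kap K) (saddle η K)).re) _ K :=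
    reCLM.hasFDerivAt.comp_hasDerivAt K h
  refine hre.congr_deriv ?_
  have e : -(2 * Real.pi * (η / diag) ^ 2) * (W' / saddle η K) +
      Real.pi * (((2 : ℕ) : ℂ) * saddle η K ^ (2 - 1) * W') -
      (2 * Real.pi * (((1 : ℝ) : ℂ) / diag) * saddle η K + 2 * Real.pi * kap K * W') =
      -(Real.pi : ℂ) * ((K + discRoot η K) / I) := by
    rw [← saddle_mul_coSaddle η K, ← saddle_sub_coSaddle η K, ← diag_sq]
    have hd : (K : ℂ) + discRoot η K = 2 * diag * saddle η K := by
      rw [saddle, mul_div_cancel₀ _ (mul_ne_zero two_ne_zero diag_ne_zero)]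
    rw [hd]
    have := diag_ne_zero
    field_simp
    push_cast
    ring
  rw [reCLM_apply]
  refine (congrArg re e).trans ?_
  rw [div_I, ← ofReal_neg, re_ofReal_mul]
  simp

/-- Integrate the derivative of the critical value from 0 to K, using `discRoot_im_ge`; the lower
bound 4ab/(K + 2a) has a logarithm as primitive, whence the power. -/
theorem norm_exp_phase_saddle_le {η : ℂ} (ha : 0 < η.re) (hb : 0 < η.im) {K : ℝ} (hK : 0 ≤ K) :
    ‖exp (phase (2 * Real.pi * (η / diag) ^ 2) (kap K) (saddle η K))‖ ≤
      ‖exp (phase (2 * Real.pi * (η / diag) ^ 2) 0 (η / diag))‖ *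
        (1 + K / (2 * η.re)) ^ (-(4 * Real.pi * (η.re * η.im))) := by
  set c := 4 * Real.pi * (η.re * η.im) with hc
  set g : ℝ → ℝ := fun K =>
    (phase (2 * Real.pi * (η / diag) ^ 2) (kap K) (saddle η K)).re + c * Real.log (K + 2 * η.re)
  have hder : ∀ K : ℝ, 0 ≤ K → HasDerivAt g
      (-(Real.pi * (discRoot η K).im) + c * (1 / (K + 2 * η.re))) K := by
    intro K hK
    refine (hasDerivAt_phase_saddle ha hb hK).add (HasDerivAt.const_mul c ?_)
    exact ((hasDerivAt_id K).add_const (2 * η.re)).log (by simp; positivity)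
  have hanti : AntitoneOn g (Ici 0) := by
    refine antitoneOn_of_deriv_nonpos (convex_Ici 0)
      (fun K hK => (hder K hK).continuousAt.continuousWithinAt)
      (fun K hK => (hder K (interior_subset hK)).differentiableAt.differentiableWithinAt) ?_
    intro K hK
    have hK' : 0 ≤ K := interior_subset hK
    rw [(hder K hK').deriv]
    have h := mul_le_mul_of_nonneg_left (discRoot_im_ge ha hb hK') Real.pi_pos.le
    have e : c * (1 / (K + 2 * η.re)) = Real.pi * (4 * (η.re * η.im) / (K + 2 * η.re)) := by
      rw [hc]; ring
    rw [e]
    linarith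
  have h := hanti self_mem_Ici hK hK
  have hk0 : kap 0 = 0 := by simp [kap]
  simp only [g, saddle_zero ha hb, hk0, zero_add] at h
  have hX : 0 < 1 + K / (2 * η.re) := by positivity
  rw [norm_exp, norm_exp, Real.rpow_def_of_pos hX, ← Real.exp_add, Real.exp_le_exp]
  have hlog : Real.log (K + 2 * η.re) = Real.log (1 + K / (2 * η.re)) + Real.log (2 * η.re) := by
    rw [← Real.log_mul hX.ne' (by positivity)]
    congr 1
    field_simp
    ring
  rw [hlog] at h
  linarith

/-- Half of the exponent, through a lower bound for the logarithm, pays for e^{-πb}, the size of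
e^{πiη} in the leading term. Each remaining quarter gives 7.5K by Bernoulli, and 7.5² ≥ 50. -/
theorem rpow_neg_le_exp_div {a b K : ℝ} (ha : 5 ≤ a) (hb : 5 ≤ b) (hK : 3 / 2 ≤ K) :
    (1 + K / (2 * a)) ^ (-(4 * Real.pi * (a * b))) ≤
      Real.exp (-(Real.pi * b)) / (50 * K ^ 2) := by
  have hp := Real.pi_gt_three
  have ha0 : 0 < a := by linarith
  have hb0 : 0 < b := by linarith
  have hK0 : 0 < K := by linarith
  set X := 1 + K / (2 * a) with hX
  have hXpos : 0 < X := by positivity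
  have h1 : 7.5 * K ≤ X ^ (Real.pi * (a * b)) := by
    have hpab : 1 ≤ Real.pi * (a * b) := by
      have : 25 ≤ a * b := by nlinarith
      nlinarith
    have := one_add_mul_self_le_rpow_one_add (s := K / (2 * a)) (by
      have : 0 ≤ K / (2 * a) := by positivity
      linarith) hpab
    refine le_trans ?_ this
    have e : Real.pi * (a * b) * (K / (2 * a)) = Real.pi * b / 2 * K := by
      field_simp
    rw [e]
    have : 7.5 ≤ Real.pi * b / 2 := by nlinarith
    nlinarith
  have h2 : Real.exp (Real.pi * b) ≤ X ^ (2 * (Real.pi * (a * b))) := by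
    rw [Real.rpow_def_of_pos hXpos, Real.exp_le_exp]
    have hX2 : 1 + (3 / 4) / a ≤ X := by
      rw [hX, add_le_add_iff_left, div_le_div_iff₀ ha0 (by positivity)]
      nlinarith
    have h3 : (3 / 4) / (a + 3 / 4) ≤ Real.log X := by
      have hY : 0 < 1 + (3 / 4) / a := by positivity
      refine le_trans ?_ ((Real.one_sub_inv_le_log_of_pos hY).trans (Real.log_le_log hY hX2))
      apply le_of_eq
      field_simp
      ring
    have h4 : 1 / (2 * a) ≤ Real.log X := by
      refine le_trans ?_ h3
      rw [div_le_div_iff₀ (by positivity) (by positivity)]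
      linarith
    have h5 := mul_le_mul_of_nonneg_right h4 (by positivity : 0 ≤ 2 * (Real.pi * (a * b)))
    refine le_trans (le_of_eq ?_) h5
    field_simp
  have hsplit : X ^ (4 * Real.pi * (a * b)) =
      X ^ (2 * (Real.pi * (a * b))) * (X ^ (Real.pi * (a * b)) * X ^ (Real.pi * (a * b))) := by
    rw [← Real.rpow_add hXpos, ← Real.rpow_add hXpos]
    ring_nf
  rw [Real.rpow_neg hXpos.le, Real.exp_neg, div_eq_mul_inv, ← mul_inv, hsplit]
  refine inv_anti₀ (by positivity) (mul_le_mul h2 ?_ (by positivity) (by positivity))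
  calc 50 * K ^ 2 ≤ (7.5 * K) * (7.5 * K) := by nlinarith [sq_nonneg K]
    _ ≤ _ := mul_le_mul h1 h1 (by positivity) (by positivity)

/-! ### The leading term k = 0. -/

theorem norm_exp_sub_exp_le {x y : ℂ} {c : ℝ} (hx : x.re ≤ c) (hy : y.re ≤ c) :
    ‖exp x - exp y‖ ≤ Real.exp c * ‖x - y‖ := by
  refine (convex_halfSpace_re_le c).norm_image_sub_le_of_norm_hasDerivWithin_le
    (f := exp) (f' := exp) (fun z _ => (hasDerivAt_exp z).hasDerivWithinAt) (fun z hz => ?_) hy hx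
  rw [norm_exp]
  exact Real.exp_le_exp.2 hz

theorem abs_pow_three_le (v : ℝ) : |v| ^ 3 ≤ 1 / 2 * Real.exp (v ^ 2) := by
  have h := Real.sum_le_exp_of_nonneg (sq_nonneg v) 4
  norm_num [Finset.sum_range_succ, Nat.factorial] at h
  have h1 : 2 * |v| ^ 3 ≤ v ^ 2 + (v ^ 2) ^ 2 := by
    have e : v ^ 2 + (v ^ 2) ^ 2 - 2 * |v| ^ 3 = |v| ^ 2 * (|v| - 1) ^ 2 := by
      rw [← sq_abs v]; ring
    have : 0 ≤ |v| ^ 2 * (|v| - 1) ^ 2 := by positivity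
    linarith
  have hx : 0 ≤ v ^ 2 := sq_nonneg v
  have h2 : v ^ 2 + (v ^ 2) ^ 2 ≤ 1 + v ^ 2 + (v ^ 2) ^ 2 / 2 + (v ^ 2) ^ 3 / 6 := by
    nlinarith [mul_nonneg hx (sq_nonneg (v ^ 2 - 2)), sq_nonneg (v ^ 2 - 2)]
  linarith

theorem integral_shifted_gaussian (c : ℝ) :
    Integrable (fun v : ℝ => Real.exp (-(5 / 4) * v ^ 2 - c * v)) ∧
    ∫ v : ℝ, Real.exp (-(5 / 4) * v ^ 2 - c * v) =
      Real.exp (c ^ 2 / 5) * Real.sqrt (Real.pi / (5 / 4)) := by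
  have e : (fun v : ℝ => Real.exp (-(5 / 4) * v ^ 2 - c * v)) = fun v : ℝ =>
      Real.exp (c ^ 2 / 5) * (fun x : ℝ => Real.exp (-(5 / 4) * x ^ 2)) (v + 2 * c / 5) := by
    ext v
    rw [← Real.exp_add]
    ring_nf
  rw [e]
  constructor
  · exact ((integrable_exp_neg_mul_sq (b := 5 / 4) (by norm_num)).comp_add_right _).const_mul _
  · rw [integral_const_mul, integral_add_right_eq_self (μ := volume)
      (fun x : ℝ => Real.exp (-(5 / 4) * x ^ 2)), integral_gaussian]

/-- The deviation of the exponent from its quadratic approximation at the saddle point. -/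
noncomputable def phaseErr (p : ℂ) (v : ℝ) : ℂ :=
  phase (2 * Real.pi * (p * p)) 0 (p + v * I) - phase (2 * Real.pi * (p * p)) 0 p +
    2 * Real.pi * v ^ 2

theorem hasDerivAt_phaseErr {p : ℂ} (hp : 0 < p.re) (v : ℝ) :
    HasDerivAt (phaseErr p) (2 * Real.pi * I * v ^ 2 / (p + v * I)) v := by
  have h1 := hasDerivAt_phase_line hp p v
  rw [sub_self] at h1
  have h2 : HasDerivAt (fun v : ℝ => (2 * Real.pi * (v : ℂ) ^ 2 : ℂ))
      (2 * Real.pi * (2 * v)) v := by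
    have := ((hasDerivAt_id v).ofReal_comp.pow 2).const_mul (2 * Real.pi : ℂ)
    refine HasDerivAt.congr_deriv this ?_
    simp
  refine ((h1.sub_const _).add h2).congr_deriv ?_
  have hne := slitPlane_ne_zero (line_mem_slitPlane hp v)
  have hvI : (v : ℂ) * I = (p + v * I) - p := by ring
  generalize p + v * I = w at hvI hne ⊢
  field_simp
  linear_combination (-v : ℂ) * hvI

theorem norm_phaseErr_le {p : ℂ} (hp : 36 ≤ p.re) (v : ℝ) :
    ‖phaseErr p v‖ ≤ Real.pi / 18 * |v| ^ 3 := by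
  have hp0 : 0 < p.re := by linarith
  have h0 : phaseErr p 0 = 0 := by simp [phaseErr]
  have h := (convex_uIcc (0 : ℝ) v).norm_image_sub_le_of_norm_hasDerivWithin_le
    (f := phaseErr p) (C := Real.pi / 18 * |v| ^ 2)
    (fun x _ => (hasDerivAt_phaseErr hp0 x).hasDerivWithinAt) (fun x hx => ?_)
    left_mem_uIcc right_mem_uIcc
  · rw [h0, sub_zero, sub_zero, Real.norm_eq_abs] at h
    calc _ ≤ _ := h
      _ = _ := by ring
  · have hw : 36 ≤ ‖p + x * I‖ := by
      refine le_trans ?_ (re_le_norm _)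
      simpa using hp
    have hx2 : |x| ≤ |v| := by simpa using abs_sub_left_of_mem_uIcc hx
    rw [norm_div, norm_mul, norm_mul, norm_mul, norm_I, norm_pow, norm_real, norm_real,
      Complex.norm_ofNat, Real.norm_of_nonneg Real.pi_pos.le, Real.norm_eq_abs, mul_one,
      div_le_iff₀ (by linarith)]
    have h3 : |x| ^ 2 ≤ |v| ^ 2 := by gcongr
    have h4 : 0 ≤ Real.pi / 18 * |v| ^ 2 := by positivity
    nlinarith [mul_le_mul_of_nonneg_left hw h4, mul_le_mul_of_nonneg_left h3 Real.pi_pos.le]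

theorem phaseErr_re_le {p : ℂ} (hp : 0 < p.re) (him : |p.im| ≤ p.re) (v : ℝ) :
    (-(2 * Real.pi) * (v : ℂ) ^ 2 + phaseErr p v).re ≤ -(3 / 4 * Real.pi) * v ^ 2 := by
  have hn : ‖p‖ - p.re ≤ 2 * (1 - 3 / 4) * p.re := by
    have : ‖p‖ ≤ 3 / 2 * p.re := by
      refine (abs_le_of_sq_le_sq' ?_ (by positivity)).2
      rw [← normSq_eq_norm_sq, normSq_apply, ← pow_two p.im, ← sq_abs p.im]
      nlinarith [abs_nonneg p.im]
    linarith
  have h := norm_exp_phase_line_le hp (re_div_line_ge hp hn) v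
  rw [sub_self, norm_exp, norm_exp, ← Real.exp_add, Real.exp_le_exp] at h
  have e : (-(2 * Real.pi) * (v : ℂ) ^ 2 + phaseErr p v) =
      phase (2 * Real.pi * (p * p)) 0 (p + v * I) - phase (2 * Real.pi * (p * p)) 0 p := by
    rw [phaseErr]; ring
  rw [e, sub_re]
  linarith

theorem norm_exp_kap_mul_I (v : ℝ) : ‖exp (-(2 * Real.pi * kap (1 / 2) * I) * v)‖ =
    Real.exp (-(Real.sqrt 2 / 2 * Real.pi * v)) := by
  have e : (-(2 * Real.pi * kap (1 / 2) * I) * v : ℂ) =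
      ((-(2 * Real.pi * v) : ℝ) : ℂ) * (kap (1 / 2) * I) := by push_cast; ring
  rw [norm_exp, e, re_ofReal_mul, mul_I_re, kap_im]
  ring_nf

theorem integral_main_gaussian :
    ∫ v : ℝ, exp (-(2 * Real.pi) * (v : ℂ) ^ 2) * exp (-(2 * Real.pi * kap (1 / 2) * I) * v) =
      exp (Real.pi * I / 8) / Real.sqrt 2 := by
  have hneg : (-(2 * Real.pi) : ℂ).re < 0 := by simp [Real.pi_pos]
  have hpi : (Real.pi : ℂ) ≠ 0 := by exact_mod_cast Real.pi_ne_zero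
  have e : ∀ v : ℝ, exp (-(2 * Real.pi) * (v : ℂ) ^ 2) *
      exp (-(2 * Real.pi * kap (1 / 2) * I) * v) =
      exp (-(2 * Real.pi) * (v : ℂ) ^ 2 + (-(2 * Real.pi * kap (1 / 2) * I)) * v + 0) := by
    intro v
    rw [← exp_add, add_zero]
  simp_rw [e]
  rw [integral_cexp_quadratic hneg]
  have h1 : (Real.pi / -(-(2 * Real.pi)) : ℂ) ^ (1 / 2 : ℂ) = (Real.sqrt 2 : ℂ)⁻¹ := by
    have : (Real.pi / -(-(2 * Real.pi)) : ℂ) = ((2⁻¹ : ℝ) : ℂ) := by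
      push_cast; field_simp
    rw [this, ← ofReal_inv, ← Real.sqrt_inv, Real.sqrt_eq_rpow, ofReal_cpow (by norm_num)]
    norm_num
  rw [h1, mul_comm, div_eq_mul_inv]
  congr 2
  have hk := kap_sq (1 / 2)
  push_cast at hk
  field_simp
  linear_combination (16 * Real.pi * kap (1 / 2) ^ 2) * I_sq - (16 * Real.pi) * hk

/-- The line passes through the saddle for κ = 0, and the linear exponential in κ is kept exact. The
integrand splits into an explicit Gaussian `A` and the effect `B` of the cubic remainder. -/
theorem vertInt_main {p : ℂ} (hp : 36 ≤ p.re) (him : |p.im| ≤ p.re) :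
    ∃ e : ℂ, ‖e‖ ≤ 0.4 ∧ vertInt (2 * Real.pi * p ^ 2) (kap (1 / 2)) p.re =
      exp (phase (2 * Real.pi * p ^ 2) 0 p) * exp (-(2 * Real.pi * kap (1 / 2) * p)) *
        (exp (Real.pi * I / 8) / Real.sqrt 2 + e) := by
  have hp0 : 0 < p.re := by linarith
  have hneg : (-(2 * Real.pi) : ℂ).re < 0 := by simp [Real.pi_pos]
  set A : ℝ → ℂ := fun v => exp (-(2 * Real.pi) * (v : ℂ) ^ 2) *
    exp (-(2 * Real.pi * kap (1 / 2) * I) * v) with hA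
  set B : ℝ → ℂ := fun v => (exp (-(2 * Real.pi) * (v : ℂ) ^ 2 + phaseErr p v) -
    exp (-(2 * Real.pi) * (v : ℂ) ^ 2)) * exp (-(2 * Real.pi * kap (1 / 2) * I) * v) with hB
  set c : ℝ := Real.sqrt 2 / 2 * Real.pi with hc
  -- The bound |v|³ ≤ e^{v²}/2 costs one unit of the Gaussian rate 3π/4 > 9/4, which leaves 5/4.
  have hBle : ∀ v, ‖B v‖ ≤ Real.pi / 36 * Real.exp (-(5 / 4) * v ^ 2 - c * v) := by
    intro v
    simp only [hB]
    rw [norm_mul, norm_exp_kap_mul_I]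
    have h1 : (-(2 * Real.pi) * (v : ℂ) ^ 2).re ≤ -(3 / 4 * Real.pi) * v ^ 2 := by
      have : (-(2 * Real.pi) * (v : ℂ) ^ 2) = ((-(2 * Real.pi) * v ^ 2 : ℝ) : ℂ) := by
        push_cast; ring
      rw [this, ofReal_re]
      nlinarith [mul_nonneg Real.pi_pos.le (sq_nonneg v)]
    have h2 := norm_exp_sub_exp_le (phaseErr_re_le hp0 him v) h1
    rw [add_sub_cancel_left] at h2
    have h3 := norm_phaseErr_le hp v
    have h4 := abs_pow_three_le v
    calc _ ≤ (Real.exp (-(3 / 4 * Real.pi) * v ^ 2) *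
          (Real.pi / 18 * (1 / 2 * Real.exp (v ^ 2)))) * Real.exp (-(c * v)) := by
          refine mul_le_mul_of_nonneg_right (h2.trans ?_) (Real.exp_pos _).le
          refine mul_le_mul_of_nonneg_left (h3.trans ?_) (Real.exp_pos _).le
          exact mul_le_mul_of_nonneg_left h4 (by positivity)
      _ = Real.pi / 36 * Real.exp (-(3 / 4 * Real.pi) * v ^ 2 + v ^ 2 + -(c * v)) := by
          rw [Real.exp_add, Real.exp_add]; ring
      _ ≤ _ := by
          refine mul_le_mul_of_nonneg_left (Real.exp_le_exp.2 ?_) (by positivity)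
          nlinarith [mul_nonneg (sub_nonneg.2 Real.pi_gt_three.le) (sq_nonneg v)]
  obtain ⟨hgi, hge⟩ := integral_shifted_gaussian c
  have hEc : Continuous (phaseErr p) :=
    continuous_iff_continuousAt.2 fun v => (hasDerivAt_phaseErr hp0 v).continuousAt
  have hBi : Integrable B := by
    refine (hgi.const_mul (Real.pi / 36)).mono' (Continuous.aestronglyMeasurable ?_)
      (Eventually.of_forall hBle)
    fun_prop
  have hAi : Integrable A := by
    have := integrable_cexp_quadratic' hneg (-(2 * Real.pi * kap (1 / 2) * I)) 0
    refine this.congr (Eventually.of_forall fun v => ?_)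
    simp only [hA]
    rw [← exp_add, add_zero]
  refine ⟨∫ v, B v, ?_, ?_⟩
  · refine (norm_integral_le_of_norm_le (hgi.const_mul (Real.pi / 36))
      (Eventually.of_forall hBle)).trans ?_
    rw [integral_const_mul, hge]
    have hpi := Real.pi_lt_d2
    have hpi3 := Real.pi_gt_three
    have hc2 : c ^ 2 / 5 ≤ 1 := by
      rw [hc, mul_pow, div_pow, Real.sq_sqrt (by norm_num)]
      nlinarith
    have h1 : Real.exp (c ^ 2 / 5) ≤ 2.72 :=
      (Real.exp_le_exp.2 hc2).trans (Real.exp_one_lt_d9.le.trans (by norm_num))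
    have h2 : Real.sqrt (Real.pi / (5 / 4)) ≤ 1.6 := by
      rw [Real.sqrt_le_left (by norm_num)]
      linarith
    calc Real.pi / 36 * (Real.exp (c ^ 2 / 5) * Real.sqrt (Real.pi / (5 / 4)))
        ≤ 3.15 / 36 * (2.72 * 1.6) := by gcongr
      _ ≤ 0.4 := by norm_num
  · rw [← integral_main_gaussian, ← integral_add hAi hBi, vertInt_eq hp0, ← integral_const_mul]
    refine integral_congr_ae (Eventually.of_forall fun v => ?_)
    simp only [hA, hB]
    rw [← add_mul, add_sub_cancel, ← exp_add, ← exp_add, ← exp_add, phaseErr, pow_two p]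
    congr 1
    simp only [phase]
    ring

/-! ### Summing the series. -/

theorem two_pi_mul_kap_half (η : ℂ) :
    2 * Real.pi * kap (1 / 2) * (η / diag) = -(Real.pi * I * η) := by
  have h : kap (1 / 2) = 1 / 2 / diag := by rw [kap]; push_cast; rfl
  have hd := diag_ne_zero
  rw [h, show 2 * Real.pi * (1 / 2 / diag) * (η / diag) = Real.pi * η / diag ^ 2 by field_simp,
    diag_sq, div_I]
  ring

theorem norm_vertInt_saddle_le {η : ℂ} (ha : 5 ≤ η.re) (hb : 5 ≤ η.im) (hab : η.im ≤ 10 * η.re)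
    {K : ℝ} (hK : 3 / 2 ≤ K) :
    ‖vertInt (2 * Real.pi * (η / diag) ^ 2) (kap K) (saddle η K).re‖ ≤
      ‖exp (phase (2 * Real.pi * (η / diag) ^ 2) 0 (η / diag)) * exp (Real.pi * I * η)‖ *
        (1 / 25 * (1 / K ^ 2)) := by
  have ha0 : 0 < η.re := by linarith
  have hb0 : 0 < η.im := by linarith
  have hK0 : 0 ≤ K := by linarith
  have h1 := norm_vertInt_le (saddle_re_pos ha0 hb0 hK0) (norm_coSaddle_sub_re_le ha0 hb0 hab hK0)
  rw [saddle_mul_coSaddle, saddle_sub_coSaddle] at h1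
  have h2 := norm_exp_phase_saddle_le ha0 hb0 hK0
  have h3 := rpow_neg_le_exp_div ha hb hK
  have h4 : ‖exp (Real.pi * I * η)‖ = Real.exp (-(Real.pi * η.im)) := by
    rw [norm_exp]
    congr 1
    simp
  rw [norm_mul, h4]
  refine h1.trans ?_
  calc _ ≤ 2 * (‖exp (phase (2 * Real.pi * (η / diag) ^ 2) 0 (η / diag))‖ *
        (Real.exp (-(Real.pi * η.im)) / (50 * K ^ 2))) := by
        refine mul_le_mul_of_nonneg_left (h2.trans ?_) (by norm_num)
        exact mul_le_mul_of_nonneg_left h3 (norm_nonneg _)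
    _ = _ := by
        have : K ≠ 0 := by linarith
        field_simp
        norm_num

/-- Telescoping, since (n + 3/2)² ≥ (n + 1)(n + 2). -/
theorem sum_one_div_sq_le (n : ℕ) :
    ∑ k ∈ Finset.range n, 1 / ((k : ℝ) + 1 + 1 / 2) ^ 2 ≤ 1 - 1 / ((n : ℝ) + 1) := by
  induction n with
  | zero => simp
  | succ n ih =>
    rw [Finset.sum_range_succ]
    have h1 : 1 / ((n : ℝ) + 1 + 1 / 2) ^ 2 ≤ 1 / (((n : ℝ) + 1) * (n + 2)) := by
      apply one_div_le_one_div_of_le (by positivity)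
      nlinarith
    have h2 : 1 / (((n : ℝ) + 1) * (n + 2)) = 1 / ((n : ℝ) + 1) - 1 / ((n : ℝ) + 2) := by
      field_simp
      ring
    have h3 : ((n + 1 : ℕ) : ℝ) + 1 = (n : ℝ) + 2 := by push_cast; ring
    rw [h3]
    linarith

theorem two_pi_mul_sq_re (η : ℂ) :
    (2 * Real.pi * (η / diag) ^ 2 : ℂ).re = 4 * Real.pi * (η.re * η.im) := by
  have : (2 * Real.pi * (η / diag) ^ 2 : ℂ) = ((2 * Real.pi : ℝ) : ℂ) * (-(η ^ 2 * I)) := by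
    rw [div_pow, diag_sq, div_I]; push_cast; ring
  rw [this, re_ofReal_mul]
  simp [pow_two]
  ring

theorem mellin_rayKernel_asymp {η : ℂ} (ha : 5 ≤ η.re) (hb : 5 ≤ η.im)
    (hab : η.im ≤ 10 * η.re) (hn : 2704 ≤ η.re ^ 2 + η.im ^ 2) :
    ∃ e : ℂ, ‖e‖ ≤ 0.44 ∧ mellin rayKernel (2 * Real.pi * (η / diag) ^ 2) =
      -(2 * I) * diag⁻¹ * ((2 * Real.pi : ℝ) : ℂ) ^ (-(2 * Real.pi * (η / diag) ^ 2)) *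
        Gamma (2 * Real.pi * (η / diag) ^ 2) *
        (exp (phase (2 * Real.pi * (η / diag) ^ 2) 0 (η / diag)) * exp (Real.pi * I * η) *
          (exp (Real.pi * I / 8) / Real.sqrt 2 + e)) := by
  have ha0 : 0 < η.re := by linarith
  have hb0 : 0 < η.im := by linarith
  have hpi := Real.pi_gt_three
  have hs2 : Real.sqrt 2 ^ 2 = 2 := Real.sq_sqrt (by norm_num)
  have hs0 : 0 < Real.sqrt 2 := by positivity
  have hp36 : 36 ≤ (η / diag).re := by
    rw [div_diag_re]
    refine (abs_le_of_sq_le_sq' (a := 36) ?_ (by positivity)).2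
    rw [mul_pow, div_pow, hs2]
    nlinarith [mul_pos ha0 hb0]
  have hpim : |(η / diag).im| ≤ (η / diag).re := by
    rw [div_diag_re, div_diag_im, abs_mul, abs_of_pos (by positivity)]
    refine mul_le_mul_of_nonneg_left ?_ (by positivity)
    rw [abs_le]
    constructor <;> linarith
  set l : ℂ := 2 * Real.pi * (η / diag) ^ 2 with hl
  have hl1 : 1 < l.re := by
    rw [hl, two_pi_mul_sq_re]
    have : 25 ≤ η.re * η.im := by nlinarith
    nlinarith
  -- Only the leading term uses the saddle for κ = 0, where its value has the closed form required
  -- by the main term.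
  set D : ℕ → ℝ := fun k => if k = 0 then (η / diag).re else (saddle η (k + 1 / 2)).re with hD
  have hDpos : ∀ k, 0 < D k := by
    intro k
    simp only [hD]
    split_ifs
    · linarith
    · exact saddle_re_pos ha0 hb0 (by positivity)
  obtain ⟨hsum, hmel⟩ := mellin_rayKernel_eq hl1 D hDpos
  obtain ⟨e₀, he₀, hv⟩ := vertInt_main hp36 hpim
  rw [two_pi_mul_kap_half, neg_neg] at hv
  set P : ℂ := exp (phase l 0 (η / diag)) * exp (Real.pi * I * η) with hP
  have hP0 : P ≠ 0 := mul_ne_zero (exp_ne_zero _) (exp_ne_zero _)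
  set T : ℂ := ∑' k : ℕ, vertInt l (kap ((k + 1 : ℕ) + 1 / 2)) (D (k + 1)) with hT
  have hTle : ‖T‖ ≤ ‖P‖ * 0.04 := by
    have hterm : ∀ k : ℕ, ‖vertInt l (kap ((k + 1 : ℕ) + 1 / 2)) (D (k + 1))‖ ≤
        ‖P‖ * (1 / 25 * (1 / ((k : ℝ) + 1 + 1 / 2) ^ 2)) := by
      intro k
      have h := norm_vertInt_saddle_le ha hb hab (K := ((k + 1 : ℕ) : ℝ) + 1 / 2) (by
        push_cast
        have : (0 : ℝ) ≤ k := Nat.cast_nonneg k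
        linarith)
      simp only [hD, Nat.add_eq_zero_iff, one_ne_zero, and_false, if_false]
      refine h.trans (le_of_eq ?_)
      push_cast
      rfl
    have hpart : ∀ n : ℕ, ∑ k ∈ Finset.range n, 1 / ((k : ℝ) + 1 + 1 / 2) ^ 2 ≤ 1 := by
      intro n
      have h1 := sum_one_div_sq_le n
      have h2 : (0 : ℝ) ≤ 1 / ((n : ℝ) + 1) := by positivity
      linarith
    have hnn : ∀ k : ℕ, (0 : ℝ) ≤ 1 / ((k : ℝ) + 1 + 1 / 2) ^ 2 := fun k => by positivity
    have hS := summable_of_sum_range_le hnn hpart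
    have hle := Real.tsum_le_of_sum_range_le hnn hpart
    refine (tsum_of_norm_bounded ((hS.hasSum.mul_left (1 / 25)).mul_left ‖P‖) hterm).trans ?_
    refine mul_le_mul_of_nonneg_left ?_ (norm_nonneg _)
    linarith
  refine ⟨e₀ + T / P, ?_, ?_⟩
  · have h1 : ‖T / P‖ ≤ 0.04 := by
      rw [norm_div, div_le_iff₀ (norm_pos_iff.2 hP0)]
      linarith
    have := norm_add_le e₀ (T / P)
    norm_num at *
    linarith
  · rw [hmel, hsum.tsum_eq_zero_add]
    have h0 : vertInt l (kap ((0 : ℕ) + 1 / 2)) (D 0) =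
        P * (exp (Real.pi * I / 8) / Real.sqrt 2 + e₀) := by
      rw [← hv]
      simp [hD, hl]
    rw [h0]
    have hTP : T = P * (T / P) := by field_simp
    rw [← hT, hTP, mul_div_cancel_left₀ _ hP0]
    ring

/-! ### The region G in terms of η. -/

theorem eta_eq (s : ℂ) : eta s = diag * ((1 - s) / (2 * Real.pi)) ^ (1 / 2 : ℂ) := rfl

theorem one_sub_eq (s : ℂ) : 1 - s = 2 * Real.pi * (eta s / diag) ^ 2 := by
  have hpi : (Real.pi : ℂ) ≠ 0 := by exact_mod_cast Real.pi_ne_zero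
  rw [div_pow, eta_sq, diag_sq]
  field_simp
  linear_combination (1 - s) * I_sq

theorem div_two_pi_mem_slitPlane {s : ℂ} (hs : s.re < 0) :
    (1 - s) / (2 * Real.pi) ∈ slitPlane := by
  left
  have : (1 - s) / (2 * Real.pi) = (((2 * Real.pi)⁻¹ : ℝ) : ℂ) * (1 - s) := by
    push_cast; rw [div_eq_inv_mul]
  rw [this, re_ofReal_mul]
  have h : 0 < (1 - s).re := by simp; linarith
  positivity

theorem eta_div_diag_re_pos {s : ℂ} (hs : s.re < 0) : 0 < (eta s / diag).re := by
  rw [eta_eq, mul_div_cancel_left₀ _ diag_ne_zero]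
  exact re_cpow_half_pos (div_two_pi_mem_slitPlane hs)

theorem eta_re_mul_im (s : ℂ) : 4 * Real.pi * ((eta s).re * (eta s).im) = 1 - s.re := by
  rw [← two_pi_mul_sq_re, ← one_sub_eq]; simp

theorem eta_re_sq_sub (s : ℂ) : 2 * Real.pi * ((eta s).re ^ 2 - (eta s).im ^ 2) = s.im := by
  have h := congrArg im (one_sub_eq s)
  have e : (2 * Real.pi * (eta s / diag) ^ 2 : ℂ) =
      ((2 * Real.pi : ℝ) : ℂ) * (-(eta s ^ 2 * I)) := by
    rw [div_pow, diag_sq, div_I]; push_cast; ring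
  rw [e, im_ofReal_mul] at h
  simp [pow_two] at h
  linarith

theorem eta_re_sq_add (s : ℂ) : 2 * Real.pi * ((eta s).re ^ 2 + (eta s).im ^ 2) = ‖s - 1‖ := by
  rw [norm_sub_rev, one_sub_eq s, norm_mul, norm_mul, norm_pow, norm_div, norm_diag, div_one,
    ← normSq_eq_norm_sq, normSq_apply, norm_real, Real.norm_of_nonneg Real.pi_pos.le,
    Complex.norm_ofNat]
  ring

theorem eta_quadrant {s : ℂ} (hs : s.re < 0) : 0 < (eta s).re ∧ 0 < (eta s).im := by
  have h1 := eta_div_diag_re_pos hs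
  rw [div_diag_re] at h1
  have h2 : 0 < (eta s).re + (eta s).im :=
    (mul_pos_iff_of_pos_left (by positivity)).1 h1
  have h3 : 0 < (eta s).re * (eta s).im := by
    have h := eta_re_mul_im s
    have hp := Real.pi_pos
    by_contra hneg
    push Not at hneg
    nlinarith
  rcases mul_pos_iff.1 h3 with h | h
  · exact h
  · linarith [h.1, h.2]

/-- With η = a + ib one has 1 - σ = 4πab, t = 2π(a² - b²) and |s - 1| = 2π(a² + b²). The radius
condition becomes a² + b² ≥ 52², and the lower bound on t becomes (b - 10a)(b + a/10) ≤ 0. These two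
force a ≥ 5, and the parabola condition 8a²b² ≥ 225(a² - b²) forces b ≥ 5. -/
theorem eta_bounds {s : ℂ} (hs : s ∈ G) : 5 ≤ (eta s).re ∧ 5 ≤ (eta s).im ∧
    (eta s).im ≤ 10 * (eta s).re ∧ 2704 ≤ (eta s).re ^ 2 + (eta s).im ^ 2 := by
  obtain ⟨h1, h2, h3, h4⟩ := hs
  have hp := Real.pi_pos
  obtain ⟨ha, hb⟩ := eta_quadrant h1
  rw [← eta_re_sq_add] at h2
  rw [← eta_re_mul_im s, ← eta_re_sq_sub s] at h3 h4
  set a := (eta s).re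
  set b := (eta s).im
  have k2 : 2704 ≤ a ^ 2 + b ^ 2 := by
    by_contra hneg
    push Not at hneg
    nlinarith
  have k3 : 0 ≤ a ^ 2 - b ^ 2 + 9.9 * (a * b) := by
    have : 0 ≤ 2 * Real.pi * (a ^ 2 - b ^ 2 + 9.9 * (a * b)) := by linarith
    exact nonneg_of_mul_nonneg_right this (by positivity)
  have k4 : 225 * (a ^ 2 - b ^ 2) ≤ 8 * (a ^ 2 * b ^ 2) := by
    have : 0 ≤ 2 * Real.pi ^ 2 * (8 * (a ^ 2 * b ^ 2) - 225 * (a ^ 2 - b ^ 2)) := by linarith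
    have := nonneg_of_mul_nonneg_right this (by positivity)
    linarith
  have k5 : b ≤ 10 * a := by
    by_contra hneg
    push Not at hneg
    nlinarith [mul_pos (sub_pos.2 hneg) (by positivity : 0 < b + 0.1 * a)]
  refine ⟨?_, ?_, k5, k2⟩
  · by_contra hneg
    push Not at hneg
    nlinarith
  · by_contra hneg
    push Not at hneg
    have hb2 : b ^ 2 < 25 := by nlinarith
    have ha2 : 2679 < a ^ 2 := by linarith
    nlinarith [mul_pos (sub_pos.2 hb2) (by positivity : 0 < a ^ 2)]

theorem re_lt_neg_one {s : ℂ} (hs : s ∈ G) : s.re < -1 := by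
  obtain ⟨h1, h2, -, -⟩ := eta_bounds hs
  have h := eta_re_mul_im s
  have : 25 ≤ (eta s).re * (eta s).im := by nlinarith
  nlinarith [Real.pi_gt_three]

theorem isClosed_G : IsClosed G := by
  have e : G = {s | s.re ≤ 0 ∧ 5408 * Real.pi ≤ ‖s - 1‖ ∧ -(99 / 20) * (1 - s.re) ≤ s.im ∧
      225 * Real.pi * s.im ≤ (1 - s.re) ^ 2} := by
    ext s
    -- The strict inequality may be relaxed: on σ = 0 the other conditions bound t, which
    -- contradicts the large radius.
    refine ⟨fun h => ⟨h.1.le, h.2⟩, fun h => ⟨lt_of_le_of_ne h.1 fun h0 => ?_, h.2⟩⟩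
    obtain ⟨-, h2, h3, h4⟩ := h
    rw [h0] at h3 h4
    have hp := Real.pi_gt_three
    have h5 : s.im ≤ 1 := by
      by_contra hneg
      push Not at hneg
      nlinarith
    have h6 := norm_le_abs_re_add_abs_im (s - 1)
    have h7 : |(s - 1).re| = 1 := by simp [h0]
    have h8 : |(s - 1).im| ≤ 5 := by
      rw [abs_le]; simp; constructor <;> linarith
    linarith
  rw [e]
  have c1 : IsClosed {s : ℂ | s.re ≤ 0} := isClosed_le (by fun_prop) (by fun_prop)
  have c2 : IsClosed {s : ℂ | 5408 * Real.pi ≤ ‖s - 1‖} := isClosed_le (by fun_prop) (by fun_prop)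
  have c3 : IsClosed {s : ℂ | -(99 / 20) * (1 - s.re) ≤ s.im} :=
    isClosed_le (by fun_prop) (by fun_prop)
  have c4 : IsClosed {s : ℂ | 225 * Real.pi * s.im ≤ (1 - s.re) ^ 2} :=
    isClosed_le (by fun_prop) (by fun_prop)
  exact c1.inter (c2.inter (c3.inter c4))

/-! ### Comparison with the main term. -/

/-- The main term with its zeros, those of `sin (π s / 2)`, removed; see `mainTerm_eq`. -/
noncomputable def mainFactor (s : ℂ) : ℂ :=
  -(2 ^ s * (Real.pi : ℂ) ^ (s - 1) * Gamma (1 - s)) * eta s ^ (s - 1) *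
    exp (-(Real.pi * I * eta s ^ 2)) *
    ((Real.sqrt 2 : ℂ) * exp (3 * Real.pi * I / 8) * sin (Real.pi * eta s) /
      (2 * cos (2 * Real.pi * eta s))) / (diag * exp (Real.pi * I * s / 4))

theorem mainTerm_eq (s : ℂ) : mainTerm s =
    diag * exp (Real.pi * I * s / 4) * sin (Real.pi * s / 2) * mainFactor s := by
  have h1 := diag_ne_zero
  have h2 := exp_ne_zero (Real.pi * I * s / 4)
  rw [mainTerm, mainFactor, chi]
  field_simp

theorem sin_pi_eta_ne_zero {s : ℂ} (hs : s.re < 0) : sin (Real.pi * eta s) ≠ 0 := by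
  have h := abs_sinh_im_le_norm_sin (Real.pi * eta s)
  rw [im_ofReal_mul] at h
  have hpos : 0 < Real.sinh (Real.pi * (eta s).im) :=
    Real.sinh_pos_iff.2 (mul_pos Real.pi_pos (eta_quadrant hs).2)
  rw [abs_of_pos hpos] at h
  exact norm_pos_iff.1 (hpos.trans_le h)

theorem cos_two_pi_eta_ne_zero {s : ℂ} (hs : s.re < 0) : cos (2 * Real.pi * eta s) ≠ 0 := by
  intro h
  rw [cos_eq_zero_iff] at h
  obtain ⟨k, hk⟩ := h
  have h1 := congrArg im hk
  have e1 : (2 * Real.pi * eta s : ℂ) = ((2 * Real.pi : ℝ) : ℂ) * eta s := by push_cast; ring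
  have e2 : ((2 * k + 1) * Real.pi / 2 : ℂ) = (((2 * k + 1) * Real.pi / 2 : ℝ) : ℂ) := by
    push_cast; ring
  rw [e1, e2, im_ofReal_mul, ofReal_im] at h1
  have := mul_pos (by positivity : 0 < 2 * Real.pi) (eta_quadrant hs).2
  linarith

theorem eta_ne_zero {s : ℂ} (hs : s.re < 0) : eta s ≠ 0 := by
  intro h
  have := (eta_quadrant hs).1
  rw [h] at this
  simp at this

theorem mainFactor_ne_zero {s : ℂ} (hs : s.re < 0) : mainFactor s ≠ 0 := by
  have hpi : (Real.pi : ℂ) ≠ 0 := by exact_mod_cast Real.pi_ne_zero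
  have hs2 : (Real.sqrt 2 : ℂ) ≠ 0 := by exact_mod_cast (by positivity : Real.sqrt 2 ≠ 0)
  have hcp : ∀ {x : ℂ} (w : ℂ), x ≠ 0 → x ^ w ≠ 0 := fun w hx => by
    rw [Ne, cpow_eq_zero_iff]; exact fun h => hx h.1
  have hG : Gamma (1 - s) ≠ 0 := Gamma_ne_zero_of_re_pos (by simp; linarith)
  have := sin_pi_eta_ne_zero hs
  have := cos_two_pi_eta_ne_zero hs
  unfold mainFactor
  refine div_ne_zero (mul_ne_zero (mul_ne_zero (mul_ne_zero (neg_ne_zero.2 (mul_ne_zero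
    (mul_ne_zero (hcp _ two_ne_zero) (hcp _ hpi)) hG)) (hcp _ (eta_ne_zero hs)))
    (exp_ne_zero _)) (div_ne_zero (mul_ne_zero (mul_ne_zero hs2 (exp_ne_zero _)) ?_) ?_))
    (mul_ne_zero diag_ne_zero (exp_ne_zero _))
  · assumption
  · exact mul_ne_zero two_ne_zero this

theorem differentiableAt_eta {s : ℂ} (hs : s.re < 0) : DifferentiableAt ℂ eta s := by
  have h : DifferentiableAt ℂ (fun s : ℂ => (1 - s) / (2 * Real.pi)) s :=
    DifferentiableAt.div_const (by fun_prop) _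
  exact (h.cpow_const (div_two_pi_mem_slitPlane hs)).const_mul _

theorem differentiableAt_mainFactor {s : ℂ} (hs : s.re < 0) :
    DifferentiableAt ℂ mainFactor s := by
  have hpi : (Real.pi : ℂ) ≠ 0 := by exact_mod_cast Real.pi_ne_zero
  have he := differentiableAt_eta hs
  have hG : DifferentiableAt ℂ (fun s => Gamma (1 - s)) s := by
    refine DifferentiableAt.comp (f := fun s => 1 - s) s (differentiableAt_Gamma _ fun m h => ?_)
      (by fun_prop)
    have h1 := congrArg re h
    simp at h1
    have : (0 : ℝ) ≤ m := Nat.cast_nonneg m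
    linarith
  have h2 : DifferentiableAt ℂ (fun s : ℂ => (2 : ℂ) ^ s) s :=
    differentiableAt_id.const_cpow (Or.inl two_ne_zero)
  have h3 : DifferentiableAt ℂ (fun s : ℂ => (Real.pi : ℂ) ^ (s - 1)) s :=
    DifferentiableAt.const_cpow (by fun_prop) (Or.inl hpi)
  have h4 : DifferentiableAt ℂ (fun s : ℂ => eta s ^ (s - 1)) s :=
    he.cpow (by fun_prop) (Or.inl (eta_quadrant hs).1)
  unfold mainFactor
  refine DifferentiableAt.div ?_ (by fun_prop) (mul_ne_zero diag_ne_zero (exp_ne_zero _))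
  refine DifferentiableAt.mul (DifferentiableAt.mul (DifferentiableAt.mul
    ((h2.mul h3).mul hG).neg h4) (by fun_prop)) (DifferentiableAt.div (by fun_prop) (by fun_prop) ?_)
  exact mul_ne_zero two_ne_zero (cos_two_pi_eta_ne_zero hs)

theorem diag_mul_cpow {p : ℂ} (hp : 0 < p.re) (w : ℂ) :
    (diag * p) ^ w = exp (Real.pi * I / 4 * w) * p ^ w := by
  have hp0 : p ≠ 0 := by rintro rfl; simp at hp
  have hpi := Real.pi_pos
  have hlog : log diag = Real.pi * I / 4 := by
    rw [diag, log_exp] <;> simp <;> linarith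
  have harg : arg diag = Real.pi / 4 := by
    rw [← log_im, hlog]; simp
  have h2 := abs_lt.1 (abs_arg_lt_pi_div_two_iff.2 (Or.inl hp))
  have hmul : log (diag * p) = log diag + log p := by
    rw [log_mul_eq_add_log_iff diag_ne_zero hp0, harg]
    exact ⟨by linarith [h2.1], by linarith [h2.2]⟩
  rw [cpow_def_of_ne_zero (mul_ne_zero diag_ne_zero hp0), hmul, hlog, cpow_def_of_ne_zero hp0,
    ← exp_add]
  ring_nf

theorem sin_div_cos_eq {z : ℂ} (h1 : 1 + exp (2 * Real.pi * I * z) ^ 2 ≠ 0) :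
    sin (Real.pi * z) / (2 * cos (2 * Real.pi * z)) = I / 2 * exp (Real.pi * I * z) *
      (1 - exp (2 * Real.pi * I * z)) / (1 + exp (2 * Real.pi * I * z) ^ 2) := by
  have e1 : exp (2 * Real.pi * I * z) = exp (Real.pi * I * z) ^ 2 := by
    rw [← exp_nat_mul]; push_cast; ring_nf
  have e2 : exp (Real.pi * z * I) = exp (Real.pi * I * z) := by ring_nf
  have e3 : exp (-(Real.pi * z) * I) = (exp (Real.pi * I * z))⁻¹ := by
    rw [← exp_neg]; ring_nf
  have e4 : exp (2 * Real.pi * z * I) = exp (Real.pi * I * z) ^ 2 := by rw [← e1]; ring_nf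
  have e5 : exp (-(2 * Real.pi * z) * I) = (exp (Real.pi * I * z) ^ 2)⁻¹ := by
    rw [← e1, ← exp_neg]; ring_nf
  rw [Complex.sin, Complex.cos, e2, e3, e4, e5, e1]
  rw [e1] at h1
  have hE := exp_ne_zero (Real.pi * I * z)
  generalize exp (Real.pi * I * z) = E at hE h1 ⊢
  have h1' : 1 + E ^ 4 ≠ 0 := by
    intro h; apply h1; linear_combination h
  have h2 : E ^ 2 + (E ^ 2)⁻¹ = (1 + E ^ 4) / E ^ 2 := by field_simp; ring
  have h3 : 1 + (E ^ 2) ^ 2 = 1 + E ^ 4 := by ring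
  rw [h2, h3]
  field_simp

/-- Puts the factor in the shape of the leading term of `mellin_rayKernel_asymp`, times (1 - q)/(1 +
q²) with q = e^{2πiη}, so that everything common cancels in the quotient. -/
theorem mainFactor_eq {s : ℂ} (hs : s.re < 0)
    (hq : 1 + exp (2 * Real.pi * I * eta s) ^ 2 ≠ 0) :
    mainFactor s = -(2 * I) * diag⁻¹ * ((2 * Real.pi : ℝ) : ℂ) ^ (-(1 - s)) * Gamma (1 - s) *
      (exp (phase (1 - s) 0 (eta s / diag)) * exp (Real.pi * I * eta s) *
        (exp (Real.pi * I / 8) / Real.sqrt 2)) *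
      ((1 - exp (2 * Real.pi * I * eta s)) / (1 + exp (2 * Real.pi * I * eta s) ^ 2)) := by
  have hp := eta_div_diag_re_pos hs
  have hp0 : eta s / diag ≠ 0 := div_ne_zero (eta_ne_zero hs) diag_ne_zero
  have hpi : (Real.pi : ℂ) ≠ 0 := by exact_mod_cast Real.pi_ne_zero
  have hs0 : (Real.sqrt 2 : ℂ) ≠ 0 := by exact_mod_cast (by positivity : Real.sqrt 2 ≠ 0)
  have hd := diag_ne_zero
  have h1 : eta s ^ (s - 1) = exp (-(Real.pi * I * (1 - s) / 4)) * (eta s / diag) ^ (-(1 - s)) := by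
    have := diag_mul_cpow hp (s - 1)
    rw [mul_div_cancel₀ _ hd] at this
    rw [this]
    ring_nf
  have h2 : (2 : ℂ) ^ s * (Real.pi : ℂ) ^ (s - 1) = 2 * ((2 * Real.pi : ℝ) : ℂ) ^ (-(1 - s)) := by
    have e : ((2 * Real.pi : ℝ) : ℂ) = ((2 : ℝ) : ℂ) * (Real.pi : ℂ) := by push_cast; rfl
    rw [e, mul_cpow_ofReal_nonneg (by norm_num) Real.pi_pos.le, neg_sub]
    have : (2 : ℂ) ^ s = 2 * ((2 : ℝ) : ℂ) ^ (s - 1) := by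
      push_cast
      rw [cpow_sub _ _ two_ne_zero, cpow_one]
      field_simp
    rw [this]
    ring
  have h3 : exp (phase (1 - s) 0 (eta s / diag)) =
      (eta s / diag) ^ (-(1 - s)) * exp (-(Real.pi * I * eta s ^ 2)) := by
    rw [exp_phase hp0]
    congr 2
    rw [div_pow, diag_sq, div_I]
    ring
  have h4 : exp (Real.pi * I * s / 4) = diag * exp (-(Real.pi * I * (1 - s) / 4)) := by
    rw [diag, ← exp_add]
    ring_nf
  have h5 : exp (3 * Real.pi * I / 8) = diag * exp (Real.pi * I / 8) := by
    rw [diag, ← exp_add]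
    ring_nf
  have h6 : (Real.sqrt 2 : ℂ) * Real.sqrt 2 = 2 := sqrt_two_mul_self_complex
  have hX : (Real.sqrt 2 : ℂ) * exp (3 * Real.pi * I / 8) * sin (Real.pi * eta s) /
      (2 * cos (2 * Real.pi * eta s)) = (Real.sqrt 2 : ℂ) * exp (3 * Real.pi * I / 8) *
      (sin (Real.pi * eta s) / (2 * cos (2 * Real.pi * eta s))) := by ring
  rw [mainFactor, hX, sin_div_cos_eq hq, h1, h2, h3, h4, h5]
  have hE := exp_ne_zero (-(Real.pi * I * (1 - s) / 4))
  generalize exp (-(Real.pi * I * (1 - s) / 4)) = x at hE ⊢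
  generalize (1 - exp (2 * Real.pi * I * eta s)) = y
  generalize 1 + exp (2 * Real.pi * I * eta s) ^ 2 = z at hq ⊢
  generalize (Real.sqrt 2 : ℂ) = r at hs0 h6 ⊢
  field_simp
  linear_combination (-(Gamma (1 - s) * (eta s / diag) ^ (-(1 - s)) * y)) * h6

/-- The quotient is (1 + A)(1 + B): A is the series error 0.44 scaled by √2 < 1.5, so at most 0.66,
and B is the deviation of (1 + q²)/(1 - q) from 1, at most 0.02 because |q| = e^{-2πb} is tiny. -/
theorem ratio_bound {s : ℂ} (hs : s ∈ G) :
    ‖mellin rayKernel (1 - s) / mainFactor s - 1‖ < 0.9 := by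
  obtain ⟨ha, hb, hab, hn⟩ := eta_bounds hs
  obtain ⟨e, he, hm⟩ := mellin_rayKernel_asymp ha hb hab hn
  rw [← one_sub_eq] at hm
  set q := exp (2 * Real.pi * I * eta s) with hq
  have hqn : ‖q‖ ≤ 0.01 := by
    rw [hq, norm_exp]
    have e1 : (2 * Real.pi * I * eta s).re = -(2 * Real.pi * (eta s).im) := by simp
    rw [e1]
    have h1 : -(2 * Real.pi * (eta s).im) ≤ -30 := by nlinarith [Real.pi_gt_three]
    have h2 : Real.exp (-(2 * Real.pi * (eta s).im)) ≤ Real.exp (-30) := Real.exp_le_exp.2 h1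
    have h3 : (2 : ℝ) ^ 30 ≤ Real.exp 30 := by
      have : Real.exp 30 = Real.exp 1 ^ 30 := by rw [← Real.exp_nat_mul]; norm_num
      rw [this]
      exact pow_le_pow_left₀ (by norm_num) (by linarith [Real.exp_one_gt_d9]) 30
    rw [Real.exp_neg 30] at h2
    refine h2.trans ((inv_anti₀ (by positivity) h3).trans (by norm_num))
  have hq2 : 1 + q ^ 2 ≠ 0 := by
    intro h
    have h1 : q ^ 2 = -1 := by linear_combination h
    have h2 := congrArg norm h1
    rw [norm_pow, norm_neg, norm_one] at h2
    nlinarith [norm_nonneg q]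
  have hq1 : 1 - q ≠ 0 := by
    intro h
    rw [← sub_eq_zero.1 h] at hqn
    norm_num at hqn
  have hs0 := hs.1
  have hM := mainFactor_eq hs0 hq2
  rw [← hq] at hM
  have hM0 := mainFactor_ne_zero hs0
  have hsq : (Real.sqrt 2 : ℂ) ≠ 0 := by exact_mod_cast (by positivity : Real.sqrt 2 ≠ 0)
  set A := (Real.sqrt 2 : ℂ) * exp (-(Real.pi * I / 8)) * e with hA
  have hratio : mellin rayKernel (1 - s) / mainFactor s = (1 + A) * ((1 + q ^ 2) / (1 - q)) := by
    rw [div_eq_iff hM0, hm, hM]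
    have hε := exp_ne_zero (Real.pi * I / 8)
    rw [hA, exp_neg]
    field_simp
  have hAn : ‖A‖ ≤ 0.66 := by
    rw [hA, norm_mul, norm_mul, norm_real, Real.norm_of_nonneg (Real.sqrt_nonneg 2)]
    have h1 : ‖exp (-(Real.pi * I / 8))‖ = 1 := by
      rw [show (-(Real.pi * I / 8) : ℂ) = ((-(Real.pi / 8) : ℝ) : ℂ) * I by push_cast; ring,
        norm_exp_ofReal_mul_I]
    have h2 : Real.sqrt 2 ≤ 1.5 := by rw [Real.sqrt_le_left] <;> norm_num
    rw [h1, mul_one]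
    calc Real.sqrt 2 * ‖e‖ ≤ 1.5 * 0.44 := by gcongr
      _ = 0.66 := by norm_num
  have hden : 0.99 ≤ ‖1 - q‖ := by
    have := norm_sub_norm_le (1 : ℂ) q
    rw [norm_one] at this
    linarith
  have hB : ‖(1 + q ^ 2) / (1 - q) - 1‖ ≤ 0.02 := by
    have e1 : (1 + q ^ 2) / (1 - q) - 1 = (q ^ 2 + q) / (1 - q) := by
      field_simp; ring
    rw [e1, norm_div, div_le_iff₀ (by linarith)]
    have h1 : ‖q ^ 2 + q‖ ≤ ‖q‖ ^ 2 + ‖q‖ := by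
      rw [← norm_pow]; exact norm_add_le _ _
    nlinarith [norm_nonneg q]
  rw [hratio]
  set B := (1 + q ^ 2) / (1 - q) - 1 with hBdef
  have e1 : (1 + A) * ((1 + q ^ 2) / (1 - q)) - 1 = A + B + A * B := by
    rw [hBdef]; ring
  rw [e1]
  calc ‖A + B + A * B‖ ≤ ‖A‖ + ‖B‖ + ‖A‖ * ‖B‖ := by
        rw [← norm_mul]; exact norm_add₃_le
    _ ≤ 0.66 + 0.02 + 0.66 * 0.02 := by gcongr
    _ < 0.9 := by norm_num

end RiemannAux

open RiemannAux

theorem mainTheorem1 :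
    IsClosed RiemannAux.G ∧
    (∃ U : ℂ → ℂ, AnalyticOnNhd ℂ U RiemannAux.G ∧
      ∀ s ∈ RiemannAux.G, ‖U s‖ < 0.9 ∧
        RiemannAux.R s = RiemannAux.mainTerm s * (1 + U s)) ∧
    (∀ s ∈ RiemannAux.G, RiemannAux.R s = 0 ↔ ∃ n : ℕ, 1 ≤ n ∧ s = -2 * (n : ℂ)) ∧
    (∀ s ∈ RiemannAux.G, RiemannAux.R s = 0 → analyticOrderAt RiemannAux.R s = 1) := by
  have hopen : IsOpen {s : ℂ | s.re < 0} := isOpen_lt continuous_re continuous_const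
  have hmel : ∀ s : ℂ, s.re < 0 → DifferentiableAt ℂ (fun s => mellin rayKernel (1 - s)) s := by
    intro s hs
    exact DifferentiableAt.comp (f := fun s => 1 - s) s
      (differentiableAt_mellin_rayKernel (by simp; linarith)) (by fun_prop)
  have hpi : (Real.pi : ℂ) ≠ 0 := by exact_mod_cast Real.pi_ne_zero
  have hmel0 : ∀ s ∈ G, mellin rayKernel (1 - s) ≠ 0 := by
    intro s hs h
    have := ratio_bound hs
    rw [h] at this
    norm_num at this
  have hzero : ∀ s ∈ G, R s = 0 ↔ sin (Real.pi * s / 2) = 0 := by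
    intro s hs
    rw [R_eq_mellin (re_lt_neg_one hs)]
    simp [diag_ne_zero, hmel0 s hs]
  refine ⟨isClosed_G, ⟨fun s => mellin rayKernel (1 - s) / mainFactor s - 1, ?_, ?_⟩, ?_, ?_⟩
  · have hd : DifferentiableOn ℂ (fun s => mellin rayKernel (1 - s) / mainFactor s - 1)
        {s : ℂ | s.re < 0} := fun s hs =>
      (((hmel s hs).div (differentiableAt_mainFactor hs)
        (mainFactor_ne_zero hs)).sub_const 1).differentiableWithinAt
    exact (hd.analyticOnNhd hopen).mono fun s hs => hs.1
  · intro s hs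
    refine ⟨ratio_bound hs, ?_⟩
    rw [R_eq_mellin (re_lt_neg_one hs), mainTerm_eq, add_sub_cancel]
    have := mainFactor_ne_zero hs.1
    field_simp
  · intro s hs
    rw [hzero s hs, sin_eq_zero_iff]
    constructor
    · rintro ⟨k, hk⟩
      have hsk : s = 2 * k := by
        apply mul_left_cancel₀ hpi
        linear_combination 2 * hk
      have h0 := hs.1
      rw [hsk] at h0
      have hk0 : k < 0 := by
        have : (2 * (k : ℂ)).re = 2 * (k : ℝ) := by simp
        rw [this] at h0
        have : (k : ℝ) < 0 := by linarith
        exact_mod_cast this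
      refine ⟨(-k).toNat, by omega, ?_⟩
      have h1 : (((-k).toNat : ℤ) : ℂ) = ((-k : ℤ) : ℂ) := by
        rw [Int.toNat_of_nonneg (by omega)]
      rw [hsk, ← Int.cast_natCast, h1]
      push_cast
      ring
    · rintro ⟨n, -, hn⟩
      refine ⟨-n, ?_⟩
      rw [hn]
      push_cast
      ring
  · intro s hs h0
    rw [hzero s hs] at h0
    have hs1 := re_lt_neg_one hs
    set k : ℂ → ℂ := fun s => diag * exp (Real.pi * I * s / 4) * mellin rayKernel (1 - s) with hk
    have hkd : DifferentiableOn ℂ k {s : ℂ | s.re < 0} := fun z hz =>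
      (DifferentiableAt.mul (by fun_prop) (hmel z hz)).differentiableWithinAt
    have hka : AnalyticAt ℂ k s := hkd.analyticAt (hopen.mem_nhds hs.1)
    have hk0 : k s ≠ 0 :=
      mul_ne_zero (mul_ne_zero diag_ne_zero (exp_ne_zero _)) (hmel0 s hs)
    set f : ℂ → ℂ := fun s => sin (Real.pi * s / 2) with hf
    have hfd : Differentiable ℂ f := by rw [hf]; fun_prop
    have hfa : AnalyticAt ℂ f s := hfd.analyticAt s
    -- G is not open, but the order of vanishing needs a full neighbourhood; the factorization holds
    -- on the open half-plane σ < -1, which contains G.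
    have hcong : R =ᶠ[𝓝 s] f * k := by
      have ho : IsOpen {z : ℂ | z.re < -1} := isOpen_lt continuous_re continuous_const
      filter_upwards [ho.mem_nhds hs1] with z hz
      rw [R_eq_mellin hz]
      simp only [hf, hk, Pi.mul_apply]
      ring
    have hder : HasDerivAt f (cos (Real.pi * s / 2) * (Real.pi / 2)) s := by
      have h1 : HasDerivAt (fun z : ℂ => Real.pi * z / 2) (Real.pi / 2) s := by
        simpa using ((hasDerivAt_id s).const_mul (Real.pi : ℂ)).div_const 2
      exact h1.csin
    have hder0 : deriv f s ≠ 0 := by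
      rw [hder.deriv]
      refine mul_ne_zero (fun hc => ?_) (div_ne_zero hpi two_ne_zero)
      have := sin_sq_add_cos_sq (Real.pi * s / 2)
      rw [h0, hc] at this
      norm_num at this
    have hford : analyticOrderAt f s = 1 := by
      have := hfa.analyticOrderAt_sub_eq_one_of_deriv_ne_zero hder0
      have hfs : f s = 0 := h0
      simpa [hfs] using this
    rw [analyticOrderAt_congr hcong, analyticOrderAt_mul hfa hka, hford,
      hka.analyticOrderAt_eq_zero.2 hk0, add_zero]
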